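/- Let $T$ be a complete first-order theory in a language $L$, let $\kappa>|L|+\aleph_0$ be a cardinal, and let $\mathfrak C$ be a $\kappa$-saturated model of $T$ (for example a monster model). Suppose that $T$ is NIP, i.e. for no formula $\varphi(\bar x,\bar y)$ is it true that for every $n$ there are $\bar y_0,\dots,\bar y_{n-1}$ in $\mathfrak C$ such that for every $\eta:\{0,\dots,n-1\}\to\{0,1\}$ some $\bar x$ in $\mathfrak C$ satisfies $\varphi(\bar x,\bar y_\ell)\Leftrightarrow\eta(\ell)=1$ for all $\ell<n$. Suppose also that $T$ is unstable, i.e. for every infinite cardinal $\mu$ there are a model $N$ of $T$ and a set $A\subseteq N$ with $|A|\le\mu$ and $|S^n(A)|>\mu$ for some $n<\omega$. Terminology. For $M\prec\mathfrak C$, an ultrafilter $D$ on ${}^mM$ and $B\subseteq\mathfrak C$, let $\mathrm{Av}(B,D)$ be the set of formulas $\varphi(\bar x)$ over $B$ with $\{\bar a\in{}^mM:\mathfrak C\models\varphi(\bar a)\}\in D$. A sequence $\langle\bar b_t:t\in I\rangle$ of $m$-tuples of $\mathfrak C$ indexed by an infinite linear order is $D$-indiscernible over $M$ if $\mathrm{tp}(\bar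 b_t,M\cup\{\bar b_s:s<t\})=\mathrm{Av}(M\cup\{\bar b_s:s<t\},D)$ for all $t\in I$. A type $p\in S^m(M)$ is stable if there are an ultrafilter $D$ on ${}^mM$ with $\mathrm{Av}(M,D)=p$ and a $D$-indiscernible sequence over $M$ that is an indiscernible set; otherwise $p$ is nonstable. Indiscernibility of sequences and sets is over $\emptyset$ unless said otherwise. A quasi-order is a reflexive transitive relation $\le$; $a$ is strictly below $b$ if $a\le b$ and not $b\le a$. Then: 1. There are $M\prec\mathfrak C$ with $|M|<\kappa$ and a nonstable type $p\in S^1(M)$. 2. There is an indiscernible sequence $\langle b_n:n<\omega\rangle$ of single elements of $\mathfrak C$ that is not an indiscernible set. 3. Let $I$ be a dense linear order and let $\langle\bar b_t:t\in I\rangle$ be an indiscernible sequence of $m$-tuples of $\mathfrak C$ that is not an indiscernible set. Then there are $r<s$ in $I$, finitely many indices $t_0,\dots,t_{k-1}\in I\setminus(r,s)$ and a formula $\psi(\bar x,\bar y;\bar z_0,\dots,\bar z_{k-1})$ of $L$ such that $\psi(\bar x,\bar y;\bar b_{t_0},\dots,\bar b_{t_{k-1}})$ defines a quasi-order on ${}^m\mathfrak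 C$ in which $\langle\bar b_t:r<t<s\rangle$ is strictly increasing. 4. There are a formula $\varphi(x,y;\bar z)$ of $L$ with $x,y$ single variables and a finite tuple $\bar c$ from $\mathfrak C$ such that $\varphi(x,y;\bar c)$ defines a quasi-order on $\mathfrak C$ with an infinite chain, namely a sequence $\langle e_n:n<\omega\rangle$ with $e_i$ strictly below $e_j$ whenever $i<j$. -/

import Mathlib

open FirstOrder Cardinal

universe u v w x

namespace NIPTheory

open FirstOrder.Language

section Types

variable {L : FirstOrder.Language.{u, v}} {C : Type w} [L.Structure C]

/-- The complete type of the tuple `b` over the set `B`, as a set of formulas with parameters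
from `B`. -/
def tp (L : FirstOrder.Language.{u, v}) {C : Type w} [L.Structure C] {m : ℕ} (B : Set C) (b : Fin m → C) :
    Set (L[[B]].Formula (Fin m)) :=
  {φ | φ.Realize b}

/-- `S^m(B)`: complete `m`-types over the subset `B` of the structure `C`, that is, maximal
satisfiable sets of formulas in `m` variables with parameters from `B` that contain the
complete theory of `C` with names for the elements of `B`. -/
abbrev TypesOver (L : FirstOrder.Language.{u, v}) {C : Type w} [L.Structure C] (m : ℕ) (B : Set C) :
    Type (max u v w) :=
  (L[[B]].completeTheory C).CompleteType (Fin m)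

/-- The set of formulas that belong to a complete type. -/
def TypesOver.formulas {m : ℕ} {B : Set C} (p : TypesOver L m B) :
    Set (L[[B]].Formula (Fin m)) :=
  {φ | Formula.equivSentence φ ∈ p}

/-- `C` is `κ`-saturated: every complete 1-type over a set of fewer than `κ` parameters is
realized in `C`. -/
def IsSaturated (L : FirstOrder.Language.{u, v}) (C : Type w) [L.Structure C] (κ : Cardinal.{w}) : Prop :=
  ∀ B : Set C, #B < κ → ∀ p : TypesOver L 1 B, ∃ b : Fin 1 → C, p.formulas = tp L B b

end Types

section Dividing

/-- The formula `φ(x̄, ȳ)` has the independence property in `C`. -/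
def HasIP {L : FirstOrder.Language.{u, v}} (C : Type w) [L.Structure C] {m k : ℕ}
    (φ : L.Formula (Fin m ⊕ Fin k)) : Prop :=
  ∀ n : ℕ, ∃ y : Fin n → Fin k → C, ∀ η : Fin n → Bool, ∃ x : Fin m → C,
    ∀ l : Fin n, φ.Realize (Sum.elim x (y l)) ↔ η l = true

/-- No formula has the independence property in `C`. For a model `C` of a complete theory `T`
this says that `T` is NIP. -/
def IsNIP (L : FirstOrder.Language.{u, v}) (C : Type w) [L.Structure C] : Prop :=
  ∀ (m k : ℕ) (φ : L.Formula (Fin m ⊕ Fin k)), ¬ HasIP C φ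

/-- `T` is stable in `μ`: over at most `μ` parameters in a model of `T` there are at most `μ`
complete types in finitely many variables. -/
def IsStableIn {L : FirstOrder.Language.{u, v}} (T : L.Theory) (μ : Cardinal.{max u v}) : Prop :=
  ∀ (M : Theory.ModelType.{u, v, max u v} T) (A : Set M), #A ≤ μ →
    ∀ n : ℕ, #(TypesOver L n A) ≤ μ

/-- `T` is stable: it is stable in some infinite cardinal. -/
def IsStable {L : FirstOrder.Language.{u, v}} (T : L.Theory) : Prop :=
  ∃ μ : Cardinal.{max u v}, ℵ₀ ≤ μ ∧ IsStableIn T μ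

end Dividing

section Indiscernibles

variable (L : FirstOrder.Language.{u, v}) {C : Type w} [L.Structure C]

/-- `⟨b_t : t ∈ I⟩` is an indiscernible sequence of `m`-tuples (over the empty set). -/
def IsIndiscernibleSeq {I : Type x} [LinearOrder I] {m : ℕ} (b : I → Fin m → C) : Prop :=
  ∀ (n : ℕ) (φ : L.Formula (Fin n × Fin m)) (s t : Fin n → I), StrictMono s → StrictMono t →
    (φ.Realize (fun q => b (s q.1) q.2) ↔ φ.Realize (fun q => b (t q.1) q.2))

/-- `⟨b_t : t ∈ I⟩` is an indiscernible set of `m`-tuples (over the empty set): the order of the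
indices is immaterial. -/
def IsIndiscernibleSet {I : Type x} {m : ℕ} (b : I → Fin m → C) : Prop :=
  ∀ (n : ℕ) (φ : L.Formula (Fin n × Fin m)) (s t : Fin n → I),
    Function.Injective s → Function.Injective t →
    (φ.Realize (fun q => b (s q.1) q.2) ↔ φ.Realize (fun q => b (t q.1) q.2))

variable {L}

/-- `Av(B, D)`: the average over `B` of an ultrafilter `D` on the `m`-tuples of `M`. -/
def average {M : L.ElementarySubstructure C} {m : ℕ} (B : Set C) (D : Ultrafilter (Fin m → M)) :
    Set (L[[B]].Formula (Fin m)) :=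
  {φ | ∀ᶠ a in (D : Filter (Fin m → M)), φ.Realize (fun i => (a i : C))}

/-- `⟨b_t : t ∈ I⟩` is a `D`-indiscernible sequence over `M`: each `b_t` realizes the average
of `D` over `M ∪ {b_s : s < t}`. -/
def IsAverageSeq {M : L.ElementarySubstructure C} {m : ℕ} (D : Ultrafilter (Fin m → M))
    {I : Type x} [LinearOrder I] (b : I → Fin m → C) : Prop :=
  ∀ t : I, tp L ((M : Set C) ∪ {a | ∃ s < t, ∃ i, b s i = a}) (b t) =
    average ((M : Set C) ∪ {a | ∃ s < t, ∃ i, b s i = a}) D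

/-- `p ∈ S^m(M)` is a stable type: for some ultrafilter `D` on `m`-tuples of `M` with average
`p` over `M`, some infinite `D`-indiscernible sequence over `M` is an indiscernible set. -/
def IsStableType {M : L.ElementarySubstructure C} {m : ℕ}
    (p : TypesOver L m (M : Set C)) : Prop :=
  ∃ D : Ultrafilter (Fin m → M), average (M : Set C) D = p.formulas ∧
    ∃ (I : Type w) (_ : LinearOrder I) (_ : Infinite I) (b : I → Fin m → C),
      IsAverageSeq D b ∧ IsIndiscernibleSet L b

end Indiscernibles

/-- A quasi-order: a reflexive transitive relation. -/
def IsQuasiOrder {X : Type w} (R : X → X → Prop) : Prop :=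
  (∀ a, R a a) ∧ ∀ a b c, R a b → R b c → R a c

/-- `a` lies strictly below `b` in the quasi-order `R`. -/
def StrictlyBelow {X : Type w} (R : X → X → Prop) (a b : X) : Prop :=
  R a b ∧ ¬ R b a

end NIPTheory

/-! Everything turns on whether the iterated powers of an ultrafilter `D` on tuples of a model are
insensitive to permuting coordinates (`IsSymmetric`). Under NIP a symmetric `D` commutes with every
ultrafilter on finite tuples (`IsSymmetric.eventually_comm_of`): a formula telling the two orders of
choice apart would show every monotone pattern on the powers of `D`, symmetry would then give all
patterns, and this is the independence property. Hence symmetry depends only on the average of `D`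
over `M` (`IsSymmetric.of_average_eq`), while an infinite average sequence that is an indiscernible
set forces symmetry (`IsAverageSeq.isSymmetric`). One nonsymmetric `D` on single elements therefore
yields both a nonstable 1-type and, through its average sequence of order type `ω`, an indiscernible
sequence that is not a set.

Such a `D` comes from instability. Counting types with the Erdős–Makkai theorem gives a formula
`φ(x, ȳ)` with the order property and `x` a single variable (`exists_hasOP_of_not_isStable`).
Saturation gives infinite witnessing sequences, and their limits along a nonprincipal ultrafilter on
`ℕ` do not commute (`exists_not_isSymmetric`).

For the quasi-order, permutations are factored into adjacent transpositions twice. First, an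
indiscernible sequence that is not a set has an adjacent transposition changing the truth of some
formula, so a formula `Φ` with outside parameters orders it on an interval. Second, NIP forbids some
pattern of `Φ` on points of that interval, while the sorted pattern is realized by a member of the
sequence; hence some adjacent transposition turns a consistent pattern into an inconsistent one. Fix
the pattern away from the two transposed positions and compare the remaining (signed) instances of
`Φ` by inclusion: this is the quasi-order. For single elements, the sequence is first stretched to
`ℚ`. -/

namespace NIPTheory

open FirstOrder.Language Filter

/-! ### Formulas in arbitrary variables, and consistency of patterns -/

section Formulas

variable {L : FirstOrder.Language.{u, v}}

/-- A formula depends on finitely many variables only. -/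
theorem exists_fin_vars {β : Type*} (φ : L.Formula β) :
    ∃ (k : ℕ) (ψ : L.Formula (Fin k)) (f : Fin k → β),
      ∀ (M : Type w) [L.Structure M] (v : β → M), ψ.Realize (v ∘ f) ↔ φ.Realize v := by
  classical
  let e := φ.freeVarFinset.equivFin
  refine ⟨_, BoundedFormula.restrictFreeVar φ e, fun i => (e.symm i : β), ?_⟩
  intro M _ v
  exact BoundedFormula.realize_restrictFreeVar (φ := φ) (f := e)
    (v := v ∘ fun i => (e.symm i : β)) v (fun a => by simp)

/-- The formula `φ` or its negation, according to a truth value. -/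
def signed {β : Type*} (φ : L.Formula β) (b : Bool) : L.Formula β := if b then φ else ∼φ

@[simp]
theorem realize_signed {β : Type*} (φ : L.Formula β) (b : Bool) {M : Type w} [L.Structure M]
    (v : β → M) : (signed φ b).Realize v ↔ (φ.Realize v ↔ b = true) := by
  cases b <;> simp [signed]

/-- The formula saying that some `x` realizes the pattern `η` on the instances `φ(x, f l)`. -/
noncomputable def patternFormula {ι β γ δ : Type*} [Finite ι] [Finite β] (φ : L.Formula (β ⊕ γ))
    (f : ι → γ → δ) (η : ι → Bool) : L.Formula δ :=
  Formula.iExs β (Formula.iInf fun l : ι =>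
    (signed φ (η l)).relabel (Sum.elim (fun i => (Sum.inr i : δ ⊕ β)) (fun j => Sum.inl (f l j))))

theorem realize_patternFormula {ι β γ δ : Type*} [Finite ι] [Finite β] (φ : L.Formula (β ⊕ γ))
    (f : ι → γ → δ) (η : ι → Bool) {M : Type w} [L.Structure M] (v : δ → M) :
    (patternFormula φ f η).Realize v ↔
      ∃ x : β → M, ∀ l, φ.Realize (Sum.elim x (v ∘ f l)) ↔ η l = true := by
  simp only [patternFormula, Formula.realize_iExs, Formula.realize_iInf, Formula.realize_relabel,
    realize_signed]
  refine exists_congr fun x => forall_congr' fun l => ?_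
  have : (Sum.elim v x ∘ Sum.elim (fun i => (Sum.inr i : δ ⊕ β)) (fun j => Sum.inl (f l j)))
      = Sum.elim x (v ∘ f l) := by
    funext i; rcases i with i | i <;> rfl
  rw [this]

/-- In NIP structures there is no formula with the independence property, for variables indexed by
arbitrary types. -/
theorem IsNIP.exists_pattern {C : Type w} [L.Structure C] [Nonempty C] (h : IsNIP L C)
    {β γ : Type*} (φ : L.Formula (β ⊕ γ)) :
    ∃ n : ℕ, ∀ y : Fin n → γ → C, ∃ η : Fin n → Bool, ∀ x : β → C,
      ¬ ∀ l : Fin n, φ.Realize (Sum.elim x (y l)) ↔ η l = true := by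
  classical
  obtain ⟨k, ψ, f, hf⟩ := exists_fin_vars.{u, v, w} φ
  by_contra! hcon
  -- Each of the `k` variables in use belongs to one of the two sides. Both sides are padded to
  -- length `k`; the entries on the wrong side get the default value `c` and are never read.
  let g : Fin k → Fin k ⊕ Fin k := fun i => Sum.map (fun _ => i) (fun _ => i) (f i)
  refine h k k (ψ.relabel g) fun n => ?_
  obtain ⟨y, hy⟩ := hcon n
  let c := Classical.arbitrary C
  refine ⟨fun l i => Sum.elim (fun _ => c) (y l) (f i), fun η => ?_⟩
  obtain ⟨x, hx⟩ := hy η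
  refine ⟨fun i => Sum.elim x (fun _ => c) (f i), fun l => ?_⟩
  rw [← hx l, ← hf, Formula.realize_relabel]
  refine iff_of_eq (congrArg _ ?_)
  funext i
  simp only [g, Function.comp]
  rcases hfi : f i with b | b <;> simp [hfi]

/-- Models of a complete theory agree on which formulas are satisfiable. -/
theorem exists_realize_iff {T : L.Theory} (hT : T.IsComplete) (M N : Type*) [L.Structure M]
    [L.Structure N] [Nonempty M] [Nonempty N] [M ⊨ T] [N ⊨ T] {β : Type*} [Finite β]
    (φ : L.Formula β) : (∃ v : β → M, φ.Realize v) ↔ ∃ v : β → N, φ.Realize v := by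
  let σ : L.Sentence := Formula.iExs β (φ.relabel (Sum.inr : β → Empty ⊕ β))
  have key : ∀ (K : Type _) [L.Structure K], K ⊨ σ ↔ ∃ v : β → K, φ.Realize v := by
    intro K _
    simp [σ, Sentence.Realize, Formula.realize_iExs, Formula.realize_relabel]
  -- The same equivalence again, because `M` and `N` may live in different universes.
  have key' : ∀ (K : Type _) [L.Structure K], K ⊨ σ ↔ ∃ v : β → K, φ.Realize v := by
    intro K _
    simp [σ, Sentence.Realize, Formula.realize_iExs, Formula.realize_relabel]
  rw [← key M, ← key' N, hT.realize_sentence_iff, hT.realize_sentence_iff]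

/-- Translation of formulas with parameters from `B` into formulas with extra variables. -/
theorem realize_withParams {C : Type w} [L.Structure C] {B : Set C} {β : Type*}
    (φ : L.Formula (B ⊕ β)) (v : β → C) :
    Formula.Realize (M := C) (BoundedFormula.constantsVarsEquiv.symm φ : L[[B]].Formula β) v ↔
      φ.Realize (Sum.elim (fun a : B => (a : C)) v) := by
  have := BoundedFormula.realize_constantsVarsEquiv (L := L) (M := C) (α := B)
    (φ := (BoundedFormula.constantsVarsEquiv.symm φ : L[[B]].Formula β)) (v := v) (xs := default)
  rw [Equiv.apply_symm_apply] at this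
  exact this.symm

end Formulas

/-! ### Indiscernible sequences at index families with repetitions -/

section Indiscernible

variable {L : FirstOrder.Language.{u, v}} {C : Type w} [L.Structure C]

/-- In an indiscernible sequence finite families of indices in the same order configuration
realize the same formulas. -/
theorem IsIndiscernibleSeq.realize_iff {I : Type x} [LinearOrder I] {m : ℕ} {b : I → Fin m → C}
    (hb : IsIndiscernibleSeq L b) {ι : Type*} [Finite ι] (s t : ι → I)
    (hst : ∀ a a', s a ≤ s a' ↔ t a ≤ t a') (φ : L.Formula (ι × Fin m)) :
    φ.Realize (fun q => b (s q.1) q.2) ↔ φ.Realize (fun q => b (t q.1) q.2) := by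
  classical
  cases nonempty_fintype ι
  -- The indices `s a` may repeat and come in any order, so their image is enumerated increasingly;
  -- `q` picks a representative `a` for each value, and the order hypothesis makes `t ∘ q`
  -- increasing too.
  let S : Finset I := Finset.univ.image s
  let e := S.orderIsoOfFin rfl
  have hs : ∀ a, s a ∈ S := fun a => Finset.mem_image_of_mem _ (Finset.mem_univ a)
  let r : ι → Fin S.card := fun a => e.symm ⟨s a, hs a⟩
  have hr : ∀ j, ∃ a, r a = j := by
    intro j
    obtain ⟨a, -, ha⟩ := Finset.mem_image.1 (e j).2
    refine ⟨a, ?_⟩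
    simp only [r]
    rw [OrderIso.symm_apply_eq]
    exact Subtype.ext ha
  choose q hq using hr
  have hsr : ∀ a, s a = (e (r a) : I) := fun a => by simp [r]
  have hts : ∀ a a', s a = s a' → t a = t a' := fun a a' h =>
    le_antisymm ((hst _ _).1 h.le) ((hst _ _).1 h.ge)
  have htr : ∀ a, t a = t (q (r a)) := fun a => hts _ _ (by rw [hsr a, hsr (q (r a)), hq])
  have h := hb S.card (φ.relabel (Prod.map r id)) (fun j => (e j : I)) (fun j => t (q j))
    (fun i j hij => e.strictMono hij) (fun i j hij => by
      rw [← not_le, ← hst, not_le, hsr, hsr, hq, hq]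
      exact e.strictMono hij)
  rw [Formula.realize_relabel, Formula.realize_relabel] at h
  have e1 : ((fun q : Fin S.card × Fin m => b (e q.1) q.2) ∘ Prod.map r id)
      = fun q => b (s q.1) q.2 := by
    funext p; simp [hsr p.1]
  have e2 : ((fun p : Fin S.card × Fin m => b (t (q p.1)) p.2) ∘ Prod.map r id)
      = fun q => b (t q.1) q.2 := by
    funext p; simp [← htr p.1]
  rwa [e1, e2] at h

end Indiscernible

/-! ### Realizing ultrafilter limits by saturation -/

section Saturation

variable {L : FirstOrder.Language.{u, v}} {C : Type w} [L.Structure C] [Nonempty C]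

/-- Compactness: `C` itself, with suitable values for the variables, models every finite part of its
complete theory together with `S`, so `S` extends to a complete type, which saturation realizes. -/
theorem IsSaturated.exists_realize_set {κ : Cardinal.{w}} (hsat : IsSaturated L C κ) (B : Set C)
    (hB : #B < κ) (S : Set (L[[B]].Formula (Fin 1)))
    (hS : ∀ F : Finset (L[[B]].Formula (Fin 1)), (F : Set _) ⊆ S →
      ∃ b : Fin 1 → C, ∀ φ ∈ F, φ.Realize b) :
    ∃ b : Fin 1 → C, ∀ φ ∈ S, φ.Realize b := by
  classical
  let S' : Set (L[[B]][[Fin 1]].Sentence) := Formula.equivSentence '' S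
  have hne : ({p : TypesOver L 1 B | S' ⊆ ↑p} : Set (TypesOver L 1 B)).Nonempty := by
    rw [Set.nonempty_iff_ne_empty, Ne, Theory.CompleteType.setOfPred_subset_eq_empty_iff, not_not,
      Theory.isSatisfiable_iff_isFinitelySatisfiable]
    intro T0 hT0
    obtain ⟨b, hb⟩ := hS ((T0.image Formula.equivSentence.symm).filter (· ∈ S))
      (fun φ hφ => by simpa using (Finset.mem_filter.1 (Finset.mem_coe.1 hφ)).2)
    let inst : (constantsOn (Fin 1)).Structure C := constantsOn.structure b
    have hmod : C ⊨ (T0 : L[[B]][[Fin 1]].Theory) := by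
      refine ⟨fun {ψ} hψ => ?_⟩
      rcases hT0 hψ with h | ⟨φ, hφ, rfl⟩
      · have : C ⊨ (L[[B]].lhomWithConstants (Fin 1)).onTheory (L[[B]].completeTheory C) :=
          (LHom.onTheory_model _ _).2 inferInstance
        exact this.realize_of_mem _ h
      · refine (Formula.realize_equivSentence C φ).2 (hb φ ?_)
        refine Finset.mem_filter.2 ⟨Finset.mem_image.2 ⟨_, hψ, ?_⟩, hφ⟩
        simp
    exact Theory.Model.isSatisfiable C
  obtain ⟨p, hp⟩ := hne
  obtain ⟨b, hb⟩ := hsat B hB p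
  refine ⟨b, fun φ hφ => ?_⟩
  have : φ ∈ tp L B b := hb ▸ (hp ⟨φ, hφ, rfl⟩ : Formula.equivSentence φ ∈ p)
  exact this

/-- One step of the realization of an ultrafilter type in countably many variables. -/
theorem IsSaturated.exists_snoc {κ : Cardinal.{w}} (hsat : IsSaturated L C κ) (hκ : ℵ₀ < κ)
    {α : Type w} (c : α → C) (hα : #α < κ) (U : Ultrafilter (ℕ → C)) (n : ℕ) (v : Fin n → C)
    (hv : ∀ φ : L.Formula (α ⊕ Fin n),
      φ.Realize (Sum.elim c v) ↔ ∀ᶠ w : ℕ → C in U, φ.Realize (Sum.elim c fun i => w i)) :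
    ∃ a : C, ∀ φ : L.Formula (α ⊕ Fin (n + 1)),
      φ.Realize (Sum.elim c (Fin.snoc v a : Fin (n + 1) → C)) ↔
        ∀ᶠ w : ℕ → C in U, φ.Realize (Sum.elim c fun i => w i) := by
  classical
  let B : Set C := Set.range c ∪ Set.range v
  have hB : #B < κ := by
    refine (Cardinal.mk_union_le _ _).trans_lt (Cardinal.add_lt_of_lt hκ.le ?_ ?_)
    · exact Cardinal.mk_range_le.trans_lt hα
    · exact (Cardinal.lt_aleph0_of_finite _).trans hκ
  let S : Set (L[[B]].Formula (Fin 1)) := {ψ | ∃ φ : L.Formula (α ⊕ Fin (n + 1)),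
    (∀ᶠ w : ℕ → C in U, φ.Realize (Sum.elim c fun i => w i)) ∧
    ∀ a : Fin 1 → C, ψ.Realize a ↔ φ.Realize (Sum.elim c (Fin.snoc v (a 0) : Fin (n + 1) → C))}
  obtain ⟨b, hb⟩ := hsat.exists_realize_set B hB S (fun F hF => by
    have hF' : ∀ ψ : F, ∃ φ : L.Formula (α ⊕ Fin (n + 1)),
        (∀ᶠ w : ℕ → C in U, φ.Realize (Sum.elim c fun i => w i)) ∧ ∀ a : Fin 1 → C,
          ψ.1.Realize a ↔ φ.Realize (Sum.elim c (Fin.snoc v (a 0) : Fin (n + 1) → C)) :=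
      fun ψ => hF ψ.2
    choose g hg1 hg2 using hF'
    let θ : L.Formula (α ⊕ Fin (n + 1)) := Formula.iInf fun ψ : F => g ψ
    -- Quantifying out the last variable of a finite conjunction: `χ` holds for `U`-most `w`, with
    -- witness `w n`, hence it holds of `v`.
    let χ : L.Formula (α ⊕ Fin n) := Formula.iExs (Fin 1) (θ.relabel
      (Sum.elim (fun i => Sum.inl (Sum.inl i))
        (Fin.snoc (fun i => Sum.inl (Sum.inr i)) (Sum.inr 0) : Fin (n + 1) → _)))
    have hχ : ∀ u : Fin n → C, χ.Realize (Sum.elim c u) ↔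
        ∃ a : Fin 1 → C, θ.Realize (Sum.elim c (Fin.snoc u (a 0) : Fin (n + 1) → C)) := by
      intro u
      simp only [χ, Formula.realize_iExs, Formula.realize_relabel]
      refine exists_congr fun a => iff_of_eq (congrArg _ ?_)
      funext i
      rcases i with i | i
      · rfl
      · induction i using Fin.lastCases <;> simp
    have h1 : ∀ᶠ w : ℕ → C in U, χ.Realize (Sum.elim c fun i => w i) := by
      have : ∀ᶠ w : ℕ → C in U, ∀ ψ : F, (g ψ).Realize (Sum.elim c fun i => w i) :=
        eventually_all.2 hg1
      refine this.mono fun w hw => (hχ _).2 ⟨fun _ => w n, ?_⟩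
      rw [Formula.realize_iInf]
      intro ψ
      convert hw ψ using 2
      funext i
      induction i using Fin.lastCases <;> simp
    obtain ⟨a, ha⟩ := (hχ v).1 ((hv χ).2 h1)
    rw [Formula.realize_iInf] at ha
    exact ⟨a, fun ψ hψ => (hg2 ⟨ψ, hψ⟩ a).2 (ha ⟨ψ, hψ⟩)⟩)
  have key : ∀ φ : L.Formula (α ⊕ Fin (n + 1)),
      (∀ᶠ w : ℕ → C in U, φ.Realize (Sum.elim c fun i => w i)) →
      φ.Realize (Sum.elim c (Fin.snoc v (b 0) : Fin (n + 1) → C)) := by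
    intro φ hφ
    let ρ : α ⊕ Fin (n + 1) → B ⊕ Fin 1 :=
      Sum.elim (fun i => Sum.inl ⟨c i, Or.inl ⟨i, rfl⟩⟩)
        (Fin.snoc (fun i => Sum.inl ⟨v i, Or.inr ⟨i, rfl⟩⟩) (Sum.inr 0) : Fin (n + 1) → _)
    have hρ : ∀ a : Fin 1 → C, (Sum.elim (fun a : B => (a : C)) a ∘ ρ) =
        Sum.elim c (Fin.snoc v (a 0) : Fin (n + 1) → C) := by
      intro a
      funext i
      rcases i with i | i
      · rfl
      · induction i using Fin.lastCases <;> simp [ρ]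
    have hψ : ∀ a : Fin 1 → C, Formula.Realize (M := C)
        (BoundedFormula.constantsVarsEquiv.symm (φ.relabel ρ) : L[[B]].Formula (Fin 1)) a ↔
        φ.Realize (Sum.elim c (Fin.snoc v (a 0) : Fin (n + 1) → C)) := by
      intro a
      rw [← hρ, ← Formula.realize_relabel]
      exact realize_withParams _ a
    exact (hψ b).1 (hb _ ⟨φ, hφ, hψ⟩)
  -- The converse follows by applying `key` to the negation, since `U` is an ultrafilter.
  refine ⟨b 0, fun φ => ⟨fun h => ?_, key φ⟩⟩
  by_contra hcon
  rw [← Ultrafilter.eventually_not] at hcon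
  have := key (∼φ) (by simpa using hcon)
  exact this h

/-- The entries are found one at a time, each stage keeping the full type of the initial segment;
this suffices because a formula mentions finitely many variables. -/
theorem IsSaturated.exists_realize_nat {κ : Cardinal.{w}} (hsat : IsSaturated L C κ) (hκ : ℵ₀ < κ)
    {α : Type w} (c : α → C) (hα : #α < κ) (U : Ultrafilter (ℕ → C)) :
    ∃ v : ℕ → C, ∀ φ : L.Formula (α ⊕ ℕ),
      φ.Realize (Sum.elim c v) ↔ ∀ᶠ w in U, φ.Realize (Sum.elim c w) := by
  classical
  let P : (n : ℕ) → (Fin n → C) → Prop := fun n v => ∀ φ : L.Formula (α ⊕ Fin n),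
      φ.Realize (Sum.elim c v) ↔ ∀ᶠ w : ℕ → C in U, φ.Realize (Sum.elim c fun i => w i)
  have step : ∀ n (v : {v : Fin n → C // P n v}), ∃ a : C, P (n + 1) (Fin.snoc v.1 a) :=
    fun n v => hsat.exists_snoc hκ c hα U n v.1 v.2
  choose nx hnx using step
  have h0 : P 0 Fin.elim0 := fun φ => by
    have : ∀ w : ℕ → C, (fun i : Fin 0 => w i) = Fin.elim0 := fun w => Subsingleton.elim _ _
    simp [this]
  let f : (n : ℕ) → {v : Fin n → C // P n v} := fun n =>
    Nat.rec ⟨Fin.elim0, h0⟩ (fun n v => ⟨Fin.snoc v.1 (nx n v), hnx n v⟩) n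
  have hf : ∀ n, (f (n + 1)).1 = Fin.snoc (f n).1 (nx n (f n)) := fun n => rfl
  let v : ℕ → C := fun n => nx n (f n)
  have hfv : ∀ n, (f n).1 = fun i : Fin n => v i := by
    intro n
    induction n with
    | zero => exact Subsingleton.elim _ _
    | succ n ih =>
      rw [hf]
      funext i
      induction i using Fin.lastCases with
      | last => simp [v]
      | cast i => simp [ih]
  refine ⟨v, fun φ => ?_⟩
  obtain ⟨k, ψ, g, hg⟩ := exists_fin_vars.{u, v, w} φ
  obtain ⟨N, hN⟩ : ∃ N, ∀ i, ∀ j, g i = Sum.inr j → j < N := by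
    refine ⟨(Finset.univ.sup fun i => Sum.elim (fun _ => 0) id (g i)) + 1, fun i j hij => ?_⟩
    have := Finset.le_sup (f := fun i => Sum.elim (fun _ => 0) id (g i)) (Finset.mem_univ i)
    simp only [hij, Sum.elim_inr, id] at this
    omega
  -- All indices in use are below `N`, so the reduction modulo `N + 1` changes nothing; the `+ 1`
  -- keeps the modulus nonzero.
  let g' : Fin k → α ⊕ Fin (N + 1) := fun i => Sum.map id (fun j => Fin.ofNat (N + 1) j) (g i)
  have hw : ∀ w : ℕ → C, φ.Realize (Sum.elim c w) ↔
      (ψ.relabel g').Realize (Sum.elim c fun i : Fin (N + 1) => w i) := by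
    intro w
    rw [← hg, Formula.realize_relabel]
    refine iff_of_eq (congrArg _ ?_)
    funext i
    simp only [Function.comp, g']
    rcases hgi : g i with a | j
    · simp
    · have := hN i j hgi
      simp [Nat.mod_eq_of_lt (show j < N + 1 by omega)]
  have := (f (N + 1)).2 (ψ.relabel g')
  rw [hfv] at this
  simp only [hw]
  exact this

/-- In a `κ`-saturated structure, the type over fewer than `κ` parameters defined by an ultrafilter
on tuples in countably many variables is realized. -/
theorem IsSaturated.exists_realize {κ : Cardinal.{w}} (hsat : IsSaturated L C κ) (hκ : ℵ₀ < κ)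
    {α : Type w} (c : α → C) (hα : #α < κ) {β : Type*} [Countable β] (U : Ultrafilter (β → C)) :
    ∃ v : β → C, ∀ φ : L.Formula (α ⊕ β),
      φ.Realize (Sum.elim c v) ↔ ∀ᶠ w in U, φ.Realize (Sum.elim c w) := by
  obtain ⟨g, hg⟩ := Countable.exists_injective_nat β
  obtain ⟨v, hv⟩ := hsat.exists_realize_nat hκ c hα
    (U.map fun w => Function.extend g w fun _ => Classical.arbitrary C)
  refine ⟨v ∘ g, fun φ => ?_⟩
  have := hv (φ.relabel (Sum.map id g))
  simp only [Formula.realize_relabel, Ultrafilter.coe_map, eventually_map] at this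
  have e1 : Sum.elim c v ∘ Sum.map id g = Sum.elim c (v ∘ g) := by
    rw [Sum.elim_comp_map]; rfl
  have e2 : ∀ w : β → C, Sum.elim c (Function.extend g w fun _ => Classical.arbitrary C) ∘
      Sum.map id g = Sum.elim c w := by
    intro w
    rw [Sum.elim_comp_map]; exact congrArg _ (funext fun i => hg.extend_apply _ _ i)
  rw [e1] at this
  simpa only [e2] using this

end Saturation

/-! ### Adjacent transpositions -/

section Permutations

/-- A property of permutations preserved by composing with adjacent transpositions on the left. -/
theorem perm_induction_left {n : ℕ} {P : Equiv.Perm (Fin (n + 1)) → Prop} (h1 : P 1)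
    (h : ∀ (i : Fin n) σ, P σ → P (Equiv.swap i.castSucc i.succ * σ))
    (σ : Equiv.Perm (Fin (n + 1))) : P σ :=
  Submonoid.induction_of_closure_eq_top_left (Equiv.Perm.mclosure_swap_castSucc_succ n) σ h1
    (by rintro _ ⟨i, rfl⟩ σ hσ; exact h i σ hσ)

/-- A property of permutations preserved by composing with adjacent transpositions on the right. -/
theorem perm_induction_right {n : ℕ} {P : Equiv.Perm (Fin (n + 1)) → Prop} (h1 : P 1)
    (h : ∀ (i : Fin n) σ, P σ → P (σ * Equiv.swap i.castSucc i.succ))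
    (σ : Equiv.Perm (Fin (n + 1))) : P σ :=
  Submonoid.induction_of_closure_eq_top_right (Equiv.Perm.mclosure_swap_castSucc_succ n) σ h1
    (by rintro σ _ ⟨i, rfl⟩ hσ; exact h i σ hσ)

/-- Replace the entries of a tuple at two adjacent positions. -/
def replacePair {n : ℕ} {X : Type*} (u : Fin (n + 1) → X) (i : Fin n) (a b : X) : Fin (n + 1) → X :=
  fun l => if l = i.castSucc then a else if l = i.succ then b else u l

section
variable {n : ℕ} {X : Type*} (u : Fin (n + 1) → X) (i : Fin n) (a b : X)

@[simp] theorem replacePair_castSucc : replacePair u i a b i.castSucc = a := by simp [replacePair]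

@[simp] theorem replacePair_succ : replacePair u i a b i.succ = b := by
  simp [replacePair, Fin.castSucc_lt_succ.ne']

theorem replacePair_of_ne {l : Fin (n + 1)} (h : l ≠ i.castSucc) (h' : l ≠ i.succ) :
    replacePair u i a b l = u l := by simp [replacePair, h, h']

theorem replacePair_swap (l : Fin (n + 1)) :
    replacePair u i a b (Equiv.swap i.castSucc i.succ l) = replacePair u i b a l := by
  by_cases h : l = i.castSucc
  · simp [h]
  by_cases h' : l = i.succ
  · simp [h']
  rw [Equiv.swap_apply_of_ne_of_ne h h', replacePair_of_ne _ _ _ _ h h',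
    replacePair_of_ne _ _ _ _ h h']

end

theorem strictMono_replacePair {n : ℕ} {X : Type*} [LinearOrder X] {u : Fin (n + 1) → X}
    (hu : StrictMono u) {i : Fin n} {a b : X} (ha : u i.castSucc < a) (hab : a < b)
    (hb : b < u i.succ) : StrictMono (replacePair u i a b) := by
  intro l l' hl
  have hlt : (l : ℕ) < l' := hl
  simp only [replacePair, Fin.ext_iff, Fin.val_castSucc, Fin.val_succ]
  split_ifs with h1 h2 h3 h4 h5 h6 h7
  · omega
  · exact hab
  · refine (hab.trans hb).trans (hu ?_)
    simp only [Fin.lt_def, Fin.val_succ]; omega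
  · omega
  · omega
  · refine hb.trans (hu ?_)
    simp only [Fin.lt_def, Fin.val_succ]; omega
  · refine (hu ?_).trans ha
    simp only [Fin.lt_def, Fin.val_castSucc]; omega
  · refine (hu ?_).trans (ha.trans hab)
    simp only [Fin.lt_def, Fin.val_castSucc]; omega
  · exact hu hl

end Permutations

/-! ### From a failure of symmetry to an order, and comparison by inclusion -/

section QuasiOrder

variable {L : FirstOrder.Language.{u, v}} {C : Type w} [L.Structure C]

/-- An indiscernible sequence that is not an indiscernible set is ordered by a formula, on an
interval with parameters outside this interval. -/
theorem IsIndiscernibleSeq.exists_order_formula {I : Type x} [LinearOrder I] {m : ℕ}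
    {b : I → Fin m → C} (hb : IsIndiscernibleSeq L b) (hnb : ¬ IsIndiscernibleSet L b) :
    ∃ (n : ℕ) (u : Fin n → I) (p q : I) (Φ : L.Formula (Fin m ⊕ (Fin m ⊕ Fin n × Fin m))),
      p < q ∧ (∀ l, u l ≤ p ∨ q ≤ u l) ∧
      ∀ t t', p < t → t < t' → t' < q →
        Φ.Realize (Sum.elim (b t) (Sum.elim (b t') fun r => b (u r.1) r.2)) ∧
        ¬ Φ.Realize (Sum.elim (b t') (Sum.elim (b t) fun r => b (u r.1) r.2)) := by
  classical
  simp only [IsIndiscernibleSet, not_forall] at hnb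
  obtain ⟨n, φ, s, t, hs, ht, hne⟩ := hnb
  rcases n with _ | n
  · exact absurd (by rw [Subsingleton.elim s t]) hne
  have hsm : StrictMono (s ∘ Tuple.sort s) :=
    (Tuple.monotone_sort s).strictMono_of_injective (hs.comp (Tuple.sort s).injective)
  have htm : StrictMono (t ∘ Tuple.sort t) :=
    (Tuple.monotone_sort t).strictMono_of_injective (ht.comp (Tuple.sort t).injective)
  set u := s ∘ Tuple.sort s with hu
  -- By indiscernibility the truth of `φ` at a tuple of distinct indices depends only on the
  -- permutation that orders it. As `φ` separates `s` from `t`, this function of permutations is not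
  -- constant.
  let f : Equiv.Perm (Fin (n + 1)) → Prop := fun σ => φ.Realize fun q => b (u (σ q.1)) q.2
  have hfs : f (Tuple.sort s)⁻¹ ↔ φ.Realize fun q => b (s q.1) q.2 := by simp [f, hu]
  have hft : f (Tuple.sort t)⁻¹ ↔ φ.Realize fun q => b (t q.1) q.2 := by
    have := hb (n + 1) (φ.relabel (Prod.map (((Tuple.sort t)⁻¹ : Equiv.Perm _) : Fin (n + 1) → Fin (n + 1)) id)) u (t ∘ Tuple.sort t) hsm htm
    simpa [Formula.realize_relabel, f, Function.comp_def] using this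
  obtain ⟨σ, i, hσ⟩ : ∃ (σ : Equiv.Perm (Fin (n + 1))) (i : Fin n), ¬ (f σ ↔ f (Equiv.swap i.castSucc i.succ * σ)) := by
    by_contra! hcon
    have : ∀ σ, f σ ↔ f 1 := perm_induction_left Iff.rfl fun i σ h => (hcon σ i).symm.trans h
    exact hne (by rw [← hfs, ← hft, this, this (Tuple.sort t)⁻¹])
  -- The two transposed entries become the free variables; the other entries of `u` stay as
  -- parameters.
  let ρ : Fin (n + 1) × Fin m → Fin m ⊕ (Fin m ⊕ Fin (n + 1) × Fin m) := fun r =>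
    replacePair (X := Fin m → Fin m ⊕ (Fin m ⊕ Fin (n + 1) × Fin m))
      (fun l j => Sum.inr (Sum.inr (l, j))) i (fun j => Sum.inl j)
      (fun j => Sum.inr (Sum.inl j)) (σ r.1) r.2
  have hρ : ∀ a a', ((φ.relabel ρ).Realize
      (Sum.elim (b a) (Sum.elim (b a') fun r => b (u r.1) r.2)) ↔
      φ.Realize fun r => b (replacePair u i a a' (σ r.1)) r.2) := by
    intro a a'
    rw [Formula.realize_relabel]
    refine iff_of_eq (congrArg _ ?_)
    funext r
    simp only [Function.comp, ρ, replacePair]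
    split_ifs <;> rfl
  have h1 : ∀ a a', u i.castSucc < a → a < a' → a' < u i.succ →
      ((φ.relabel ρ).Realize (Sum.elim (b a) (Sum.elim (b a') fun r => b (u r.1) r.2)) ↔ f σ) := by
    intro a a' h h' h''
    rw [hρ]
    have := hb (n + 1) (φ.relabel (Prod.map σ id)) _ u (strictMono_replacePair hsm h h' h'') hsm
    rw [Formula.realize_relabel, Formula.realize_relabel] at this
    exact this
  have h2 : ∀ a a', u i.castSucc < a → a < a' → a' < u i.succ →
      ((φ.relabel ρ).Realize (Sum.elim (b a') (Sum.elim (b a) fun r => b (u r.1) r.2)) ↔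
        f (Equiv.swap i.castSucc i.succ * σ)) := by
    intro a a' h h' h''
    rw [hρ]
    have := hb (n + 1) (φ.relabel (Prod.map
      ((Equiv.swap i.castSucc i.succ * σ : Equiv.Perm _) : Fin (n + 1) → Fin (n + 1)) id)) _ u
      (strictMono_replacePair hsm h h' h'') hsm
    rw [Formula.realize_relabel, Formula.realize_relabel] at this
    refine Iff.trans (iff_of_eq (congrArg _ ?_)) this
    funext r
    simp [replacePair_swap]
  have hul : ∀ l, u l ≤ u i.castSucc ∨ u i.succ ≤ u l := fun l => by
    rcases lt_or_ge i.castSucc l with h | h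
    · right; apply hsm.monotone
      rwa [← Fin.succ_le_castSucc_iff, Fin.succ_castSucc, Fin.castSucc_le_castSucc_iff] at h
    · left; exact hsm.monotone h
  by_cases hfσ : f σ
  · refine ⟨n + 1, u, u i.castSucc, u i.succ, φ.relabel ρ, hsm Fin.castSucc_lt_succ, hul, ?_⟩
    intro t t' h h' h''
    rw [h1 t t' h h' h'', h2 t t' h h' h'']
    tauto
  · refine ⟨n + 1, u, u i.castSucc, u i.succ, ∼(φ.relabel ρ), hsm Fin.castSucc_lt_succ, hul, ?_⟩
    intro t t' h h' h''
    rw [Formula.realize_not, Formula.realize_not, h1 t t' h h' h'', h2 t t' h h' h'']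
    tauto

/-- A monotone pattern is a cut of the indices. The cut is placed half a step before the first
`true`, or at `n` if there is none, so it avoids all the indices. -/
theorem exists_rat_separating {n : ℕ} (η : Fin n → Bool) (hη : Monotone η) :
    ∃ q : ℚ, ∀ l : Fin n, q ≠ l ∧ (q < l ↔ η l = true) := by
  by_cases h : ∃ l, η l = true
  · classical
    obtain ⟨l₁, hl₁, hmin⟩ : ∃ l₁, η l₁ = true ∧ ∀ l, η l = true → l₁ ≤ l := by
      have hne : (Finset.univ.filter fun l => η l = true).Nonempty :=
        h.imp fun l hl => by simpa using hl
      refine ⟨_, (Finset.mem_filter.1 (Finset.min'_mem _ hne)).2, fun l hl => ?_⟩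
      exact Finset.min'_le _ _ (by simpa using hl)
    have key : ∀ l : Fin n, ((l₁ : ℕ) : ℚ) - 1 / 2 < ((l : ℕ) : ℚ) ↔ l₁ ≤ l := by
      intro l
      rw [Fin.le_def, ← Nat.cast_le (α := ℚ)]
      constructor
      · intro hl
        by_contra hcon
        rw [Nat.cast_le, not_le, ← Nat.succ_le_iff, ← Nat.cast_le (α := ℚ)] at hcon
        push_cast at hcon
        linarith
      · intro hl; linarith
    refine ⟨(l₁ : ℕ) - 1 / 2, fun l => ⟨fun heq => ?_, ?_⟩⟩
    · rcases le_or_gt l₁ l with hl | hl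
      · exact ((key l).2 hl).ne heq
      · have : ((l : ℕ) : ℚ) + 1 ≤ (l₁ : ℕ) := by exact_mod_cast hl
        linarith
    · rw [key]
      refine ⟨fun hl => ?_, hmin l⟩
      have := hη hl
      rw [hl₁] at this
      exact top_le_iff.1 this
  · push Not at h
    refine ⟨n, fun l => ⟨?_, ?_⟩⟩
    · exact_mod_cast l.2.ne'
    · simp only [h l, iff_false, not_lt, Bool.false_eq_true]
      exact_mod_cast l.2.le

/-- The formula `∀ x, (∧ l, ρ l (x)) → θ(x, y) → θ(x, y')`. -/
noncomputable def inclusionFormula {ι β γ δ : Type*} [Finite ι] [Finite β]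
    (ρ : ι → L.Formula (δ ⊕ β)) (θ : L.Formula (β ⊕ (γ ⊕ δ))) : L.Formula ((γ ⊕ γ) ⊕ δ) :=
  Formula.iAlls β
    (((Formula.iInf ρ).relabel (Sum.map (Sum.inr : δ → (γ ⊕ γ) ⊕ δ) id)).imp
      ((θ.relabel (Sum.elim Sum.inr
          (Sum.elim (fun i => Sum.inl (Sum.inl (Sum.inl i))) fun j => Sum.inl (Sum.inr j)))).imp
        (θ.relabel (Sum.elim Sum.inr
          (Sum.elim (fun i => Sum.inl (Sum.inl (Sum.inr i))) fun j => Sum.inl (Sum.inr j))))))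

theorem realize_inclusionFormula {ι β γ δ : Type*} [Finite ι] [Finite β]
    (ρ : ι → L.Formula (δ ⊕ β)) (θ : L.Formula (β ⊕ (γ ⊕ δ))) (y y' : γ → C) (d : δ → C) :
    (inclusionFormula ρ θ).Realize (Sum.elim (Sum.elim y y') d) ↔
      ∀ x : β → C, (∀ l, (ρ l).Realize (Sum.elim d x)) →
        θ.Realize (Sum.elim x (Sum.elim y d)) → θ.Realize (Sum.elim x (Sum.elim y' d)) := by
  simp only [inclusionFormula, Formula.realize_iAlls, Formula.realize_imp, Formula.realize_relabel,
    Formula.realize_iInf]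
  refine forall_congr' fun x => ?_
  have e1 : Sum.elim (Sum.elim (Sum.elim y y') d) x ∘ Sum.map (Sum.inr : δ → (γ ⊕ γ) ⊕ δ) id
      = Sum.elim d x := by funext i; rcases i with i | i <;> rfl
  have e2 : Sum.elim (Sum.elim (Sum.elim y y') d) x ∘ (Sum.elim Sum.inr
      (Sum.elim (fun i => Sum.inl (Sum.inl (Sum.inl i))) fun j => Sum.inl (Sum.inr j)))
      = Sum.elim x (Sum.elim y d) := by funext i; rcases i with i | i | i <;> rfl
  have e3 : Sum.elim (Sum.elim (Sum.elim y y') d) x ∘ (Sum.elim Sum.inr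
      (Sum.elim (fun i => Sum.inl (Sum.inl (Sum.inr i))) fun j => Sum.inl (Sum.inr j)))
      = Sum.elim x (Sum.elim y' d) := by funext i; rcases i with i | i | i <;> rfl
  rw [e1, e2, e3]

end QuasiOrder

/-! ### The definable quasi-order under NIP -/

section QuasiOrder

variable {L : FirstOrder.Language.{u, v}} {C : Type w} [L.Structure C] [Nonempty C]

/-- In a NIP structure, a formula that orders an indiscernible sequence on an interval has a pattern
which is consistent, but becomes inconsistent after an adjacent transposition. -/
theorem exists_adjacent_pattern {I : Type x} [LinearOrder I] {m : ℕ} {δ : Type*}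
    (hNIP : IsNIP L C) (Φ : L.Formula (Fin m ⊕ (Fin m ⊕ δ))) (d : δ → C) (b : I → Fin m → C)
    (g : ℚ → I)
    (hΦ : ∀ s t : ℚ, s ≠ t → (Φ.Realize (Sum.elim (b (g s)) (Sum.elim (b (g t)) d)) ↔ s < t)) :
    ∃ (n : ℕ) (η : Fin (n + 1) → Bool) (i : Fin n), η i.castSucc ≠ η i.succ ∧
      (∃ x : Fin m → C, ∀ l : Fin (n + 1),
        Φ.Realize (Sum.elim x (Sum.elim (b (g (l : ℕ))) d)) ↔ η l = true) ∧
      ¬ ∃ x : Fin m → C, ∀ l : Fin (n + 1), Φ.Realize (Sum.elim x (Sum.elim (b (g (l : ℕ))) d)) ↔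
        η (Equiv.swap i.castSucc i.succ l) = true := by
  obtain ⟨N, hN⟩ := hNIP.exists_pattern Φ
  obtain ⟨η, hη⟩ := hN fun l => Sum.elim (b (g (l : ℕ))) d
  rcases N with _ | n
  · exact absurd (fun l => l.elim0) (hη fun _ => Classical.arbitrary C)
  -- `η` is a pattern forbidden by NIP. Its sorted version is realized by the member of the sequence
  -- at a rational cut, so consistency is lost at some adjacent transposition on the way from one to
  -- the other.
  let η₀ := η ∘ Tuple.sort η
  let P : Equiv.Perm (Fin (n + 1)) → Prop := fun σ => ∃ x : Fin m → C, ∀ l : Fin (n + 1),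
    Φ.Realize (Sum.elim x (Sum.elim (b (g (l : ℕ))) d)) ↔ η₀ (σ l) = true
  have h1 : P 1 := by
    obtain ⟨q, hq⟩ := exists_rat_separating η₀ (Tuple.monotone_sort η)
    exact ⟨b (g q), fun l => (hΦ q l (hq l).1).trans (hq l).2⟩
  have h2 : ¬ P (Tuple.sort η)⁻¹ := by
    rintro ⟨x, hx⟩
    exact hη x (by simpa [η₀] using hx)
  obtain ⟨i, σ, hσ, hσ'⟩ : ∃ (i : Fin n) (σ : Equiv.Perm (Fin (n + 1))), P σ ∧
      ¬ P (σ * Equiv.swap i.castSucc i.succ) := by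
    by_contra! hcon
    exact h2 (perm_induction_right h1 hcon _)
  refine ⟨n, η₀ ∘ σ, i, fun heq => hσ' ?_, hσ, hσ'⟩
  obtain ⟨x, hx⟩ := hσ
  refine ⟨x, fun l => ?_⟩
  rw [hx l, Equiv.Perm.mul_apply]
  by_cases h : l = i.castSucc
  · subst h; rw [Equiv.swap_apply_left]; exact iff_of_eq (congrArg (· = true) heq)
  by_cases h' : l = i.succ
  · subst h'; rw [Equiv.swap_apply_right]; exact iff_of_eq (congrArg (· = true) heq.symm)
  rw [Equiv.swap_apply_of_ne_of_ne h h']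

/-- A pattern is consistent with the values at positions `i`, `i + 1` in one order and inconsistent
in the other. By indiscernibility this persists when these two points are moved to any `t < t'`
between them. So, among the `x` obeying the rest of the pattern, the signed instance at `t` implies
the one at `t'`, and not conversely. -/
theorem exists_quasiOrder_of_indiscernibleSeq {I : Type x} [LinearOrder I] [DenselyOrdered I]
    {m : ℕ} (hNIP : IsNIP L C) (b : I → Fin m → C) (hb : IsIndiscernibleSeq L b)
    (hnb : ¬ IsIndiscernibleSet L b) :
    ∃ (r s : I) (k : ℕ) (c : Fin k → I) (ψ : L.Formula ((Fin m ⊕ Fin m) ⊕ (Fin k × Fin m))),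
      r < s ∧ (∀ j, c j ∉ Set.Ioo r s) ∧
      ∃ R : (Fin m → C) → (Fin m → C) → Prop,
        (∀ a a', R a a' ↔ ψ.Realize (Sum.elim (Sum.elim a a') (fun q => b (c q.1) q.2))) ∧
        IsQuasiOrder R ∧
        ∀ t ∈ Set.Ioo r s, ∀ t' ∈ Set.Ioo r s, t < t' → StrictlyBelow R (b t) (b t') := by
  classical
  obtain ⟨k, u, p, q, Φ, hpq, hu, hΦ⟩ := hb.exists_order_formula hnb
  have hnt : Nontrivial (Set.Ioo p q) := by
    obtain ⟨y, hy1, hy2⟩ := exists_between hpq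
    obtain ⟨z, hz1, hz2⟩ := exists_between hy2
    exact ⟨⟨y, hy1, hy2⟩, ⟨z, hy1.trans hz1, hz2⟩, fun h => hz1.ne (congrArg Subtype.val h)⟩
  -- A copy of `ℚ`, rather than of `ℕ`, leaves room for points of the sequence at every cut of the
  -- indices `0, …, n`.
  obtain ⟨e⟩ := Order.embedding_from_countable_to_dense ℚ (Set.Ioo p q)
  let g : ℚ → I := fun s => e s
  have hg : StrictMono g := fun s t hst => e.strictMono hst
  have hgp : ∀ s, p < g s := fun s => (e s).2.1
  have hgq : ∀ s, g s < q := fun s => (e s).2.2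
  obtain ⟨n, η, i, hηi, hcons, hincons⟩ := exists_adjacent_pattern hNIP Φ
    (fun r : Fin k × Fin m => b (u r.1) r.2) b g (fun s t hst => by
      rcases lt_or_gt_of_ne hst with h | h
      · exact iff_of_true (hΦ _ _ (hgp s) (hg h) (hgq t)).1 h
      · exact iff_of_false (hΦ _ _ (hgp t) (hg h) (hgq s)).2 h.not_gt)
  let ι := Fin (n + 1) ⊕ Fin k
  let h : Fin (n + 1) → I := fun l => g (l : ℕ)
  have hh : StrictMono h := fun l l' hl => hg (Nat.cast_lt.2 hl)
  have hhp : ∀ l, p < h l := fun l => hgp _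
  have hhq : ∀ l, h l < q := fun l => hgq _
  -- consistency of a pattern is invariant under changing the indices in the interval
  let χ : (Fin (n + 1) → Bool) → L.Formula (ι × Fin m) := fun η =>
    patternFormula Φ (fun l => Sum.elim (fun j => (Sum.inl l, j)) (fun r => (Sum.inr r.1, r.2))) η
  have hχ : ∀ (η : Fin (n + 1) → Bool) (h' : Fin (n + 1) → I),
      (χ η).Realize (fun r => b (Sum.elim h' u r.1) r.2) ↔
        ∃ x : Fin m → C, ∀ l : Fin (n + 1),
          Φ.Realize (Sum.elim x (Sum.elim (b (h' l)) fun r => b (u r.1) r.2)) ↔ η l = true := by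
    intro η h'
    simp only [χ, realize_patternFormula]
    refine exists_congr fun x => forall_congr' fun l => iff_of_eq ?_
    congr 3
    funext r
    rcases r with r | r <;> rfl
  have hinv : ∀ (η : Fin (n + 1) → Bool) (t t' : I), h i.castSucc < t → t < t' → t' < h i.succ →
      ((∃ x : Fin m → C, ∀ l : Fin (n + 1), Φ.Realize (Sum.elim x
        (Sum.elim (b (replacePair h i t t' l)) fun r => b (u r.1) r.2)) ↔ η l = true) ↔
      ∃ x : Fin m → C, ∀ l : Fin (n + 1),
        Φ.Realize (Sum.elim x (Sum.elim (b (h l)) fun r => b (u r.1) r.2)) ↔ η l = true) := by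
    intro η t t' h1 h2 h3
    rw [← hχ, ← hχ]
    have hm := strictMono_replacePair hh h1 h2 h3
    have hm1 : ∀ l, p < replacePair h i t t' l ∧ replacePair h i t t' l < q := by
      intro l
      simp only [replacePair]
      split_ifs
      · exact ⟨(hhp _).trans h1, (h2.trans h3).trans (hhq _)⟩
      · exact ⟨(hhp _).trans (h1.trans h2), h3.trans (hhq _)⟩
      · exact ⟨hhp _, hhq _⟩
    refine hb.realize_iff _ _ ?_ _
    rintro (l | l) (l' | l')
    · exact hm.le_iff_le.trans hh.le_iff_le.symm
    · rcases hu l' with h | h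
      · exact iff_of_false (not_le.2 (h.trans_lt (hm1 l).1)) (not_le.2 (h.trans_lt (hhp l)))
      · exact iff_of_true ((hm1 l).2.le.trans h) ((hhq l).le.trans h)
    · rcases hu l with h | h
      · exact iff_of_true (h.trans (hm1 l').1.le) (h.trans (hhp l').le)
      · exact iff_of_false (not_le.2 ((hm1 l').2.trans_le h)) (not_le.2 ((hhq l').trans_le h))
    · rfl
  let c : Fin (n + 1 + k) → I := fun j => Sum.elim h u (finSumFinEquiv.symm j)
  let ρ : {l : Fin (n + 1) // l ≠ i.castSucc ∧ l ≠ i.succ} →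
      L.Formula ((Fin (n + 1 + k) × Fin m) ⊕ Fin m) := fun l =>
    (signed Φ (η l)).relabel (Sum.elim Sum.inr (Sum.elim
      (fun j => Sum.inl (finSumFinEquiv (Sum.inl l.1), j))
      (fun r => Sum.inl (finSumFinEquiv (Sum.inr r.1), r.2))))
  have hρ : ∀ l x, (ρ l).Realize (Sum.elim (fun r => b (c r.1) r.2) x) ↔
      (Φ.Realize (Sum.elim x (Sum.elim (b (h l)) fun r => b (u r.1) r.2)) ↔ η l = true) := by
    intro l x
    simp only [ρ, Formula.realize_relabel, realize_signed]
    refine iff_of_eq ?_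
    congr 2
    funext r
    rcases r with r | r | r <;> simp [c]
  -- The sign is the value prescribed at the later position, which makes the inclusions point
  -- upwards.
  let θ : L.Formula (Fin m ⊕ (Fin m ⊕ Fin (n + 1 + k) × Fin m)) :=
    (signed Φ (η i.succ)).relabel (Sum.map id (Sum.map id
      fun r => (finSumFinEquiv (Sum.inr r.1), r.2)))
  have hθ : ∀ x y, θ.Realize (Sum.elim x (Sum.elim y fun r => b (c r.1) r.2)) ↔
      (Φ.Realize (Sum.elim x (Sum.elim y fun r => b (u r.1) r.2)) ↔ η i.succ = true) := by
    intro x y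
    simp only [θ, Formula.realize_relabel, realize_signed]
    refine iff_of_eq ?_
    congr 2
    funext r
    rcases r with r | r | r <;> simp [c]
  have hi : i.castSucc ≠ i.succ := Fin.castSucc_lt_succ.ne
  refine ⟨h i.castSucc, h i.succ, n + 1 + k, c, inclusionFormula ρ θ, hh Fin.castSucc_lt_succ, ?_,
    fun a a' => ∀ x : Fin m → C,
      (∀ l, (ρ l).Realize (Sum.elim (fun r => b (c r.1) r.2) x)) →
        θ.Realize (Sum.elim x (Sum.elim a fun r => b (c r.1) r.2)) →
          θ.Realize (Sum.elim x (Sum.elim a' fun r => b (c r.1) r.2)), ?_, ?_, ?_⟩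
  · rintro j ⟨h1, h2⟩
    simp only [c] at h1 h2
    generalize finSumFinEquiv.symm j = w at h1 h2
    rcases w with l | l
    · rw [Sum.elim_inl] at h1 h2
      have h1' := hh.lt_iff_lt.1 h1
      have h2' := hh.lt_iff_lt.1 h2
      simp only [Fin.lt_def, Fin.val_castSucc, Fin.val_succ] at h1' h2'
      omega
    · rw [Sum.elim_inr] at h1 h2
      rcases hu l with h' | h'
      · exact (h1.trans_le h').not_gt (hhp _)
      · exact (h'.trans_lt h2).not_gt (hhq _)
  · intro a a'
    exact (realize_inclusionFormula ρ θ a a' _).symm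
  · exact ⟨fun a x _ h => h, fun a b c h1 h2 x hx h => h2 x hx (h1 x hx h)⟩
  · rintro t ⟨ht1, ht2⟩ t' ⟨ht1', ht2'⟩ htt'
    simp only [hρ, hθ]
    constructor
    · intro x hx hxt
      by_contra hxt'
      -- A counterexample `x` to the inclusion would realize the transposed pattern.
      refine hincons ((hinv (fun l => η (Equiv.swap i.castSucc i.succ l)) t t' ht1 htt' ht2').1
        ⟨x, fun l => ?_⟩)
      by_cases hl : l = i.castSucc
      · subst hl
        rw [replacePair_castSucc, Equiv.swap_apply_left]; exact hxt
      by_cases hl' : l = i.succ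
      · subst hl'
        rw [replacePair_succ, Equiv.swap_apply_right]
        revert hxt' hηi
        cases η i.castSucc <;> cases η i.succ <;> simp
      rw [Equiv.swap_apply_of_ne_of_ne hl hl', replacePair_of_ne _ _ _ _ hl hl']
      exact hx ⟨l, hl, hl'⟩
    · intro hcon
      -- A realization of the consistent pattern lies in the trace at `t'` but not in the trace at
      -- `t`.
      obtain ⟨x, hx⟩ := (hinv η t t' ht1 htt' ht2').2 hcons
      have h1 := hx i.castSucc
      have h2 := hx i.succ
      rw [replacePair_castSucc] at h1
      rw [replacePair_succ] at h2
      have h3 := hcon x (fun l => by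
        have := hx l
        rwa [replacePair_of_ne _ _ _ _ l.2.1 l.2.2] at this) h2
      exact hηi (Bool.eq_iff_iff.2 (h1.symm.trans h3))

end QuasiOrder

/-! ### Iterated powers of an ultrafilter -/

section Powers

variable {X : Type*}

/-- The iterated power of an ultrafilter; the last coordinate is chosen first. -/
def ultrafilterPower (D : Ultrafilter X) : (n : ℕ) → Ultrafilter (Fin n → X)
  | 0 => pure Fin.elim0
  | n + 1 => D.bind fun a => (ultrafilterPower D n).map fun e => Fin.snoc e a

theorem eventually_power_zero (D : Ultrafilter X) (P : (Fin 0 → X) → Prop) :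
    (∀ᶠ e in ultrafilterPower D 0, P e) ↔ P Fin.elim0 := Iff.rfl

theorem eventually_power_succ (D : Ultrafilter X) {n : ℕ} (P : (Fin (n + 1) → X) → Prop) :
    (∀ᶠ e in ultrafilterPower D (n + 1), P e) ↔
      ∀ᶠ a in D, ∀ᶠ e in ultrafilterPower D n, P (Fin.snoc e a) := Iff.rfl

/-- Associativity of the product: the first coordinate can be split off as the one chosen last.
Together with the defining recursion this gives access to both ends of a tuple. -/
theorem eventually_power_succ' (D : Ultrafilter X) {n : ℕ} (P : (Fin (n + 1) → X) → Prop) :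
    (∀ᶠ e in ultrafilterPower D (n + 1), P e) ↔
      ∀ᶠ e in ultrafilterPower D n, ∀ᶠ a in D, P (Fin.cons a e) := by
  induction n with
  | zero =>
    rw [eventually_power_succ, eventually_power_zero]
    refine eventually_congr (Eventually.of_forall fun a => ?_)
    rw [eventually_power_zero]
    exact iff_of_eq (congrArg P (by funext i; fin_cases i; rfl))
  | succ n ih =>
    rw [eventually_power_succ, eventually_power_succ]
    refine eventually_congr (Eventually.of_forall fun a => ?_)
    rw [ih]
    simp only [Fin.cons_snoc_eq_snoc_cons]

theorem eventually_power_forall (D : Ultrafilter X) {P : X → Prop} (h : ∀ᶠ a in D, P a) (n : ℕ) :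
    ∀ᶠ e : Fin n → X in ultrafilterPower D n, ∀ l, P (e l) := by
  induction n with
  | zero => exact fun l => l.elim0
  | succ n ih =>
    rw [eventually_power_succ]
    refine h.mono fun a ha => ih.mono fun e he l => ?_
    induction l using Fin.lastCases <;> simp [ha, he]

/-- If `R` fails on `D ⊗ E` but holds on `E ⊗ D`, then every monotone pattern appears on the powers
of `D`. -/
theorem eventually_power_pattern {Y : Type*} (D : Ultrafilter X) (E : Ultrafilter Y)
    (R : X → Y → Prop) (h : ∀ᶠ a in D, ∀ᶠ y in E, R a y) (h' : ∀ᶠ y in E, ∀ᶠ a in D, ¬ R a y) :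
    ∀ (n : ℕ) (η : Fin n → Bool), Monotone η → ∀ W : Y → Prop, (∀ᶠ y in E, W y) →
      ∀ᶠ e : Fin n → X in ultrafilterPower D n, ∃ y, W y ∧ ∀ l, R (e l) y ↔ η l = true := by
  intro n
  induction n with
  | zero =>
    intro η _ W hW
    obtain ⟨y, hy⟩ := hW.exists
    exact (⟨y, hy, fun l => l.elim0⟩ : ∃ y, W y ∧ ∀ l : Fin 0, _)
  | succ n ih =>
    intro η hη W hW
    -- The last coordinate is chosen first. While its value is `true`, a `D`-typical `a` is taken
    -- and `R a y` joins the condition `W`, which stays `E`-large. Once it is `false`, monotonicity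
    -- makes all remaining values `false`, and one `y` with `¬ R a y` for `D`-most `a` serves them
    -- all.
    by_cases hl : η (Fin.last n) = true
    · rw [eventually_power_succ]
      refine h.mono fun a ha => ?_
      refine (ih (η ∘ Fin.castSucc) (hη.comp Fin.strictMono_castSucc.monotone)
        (fun y => W y ∧ R a y) (hW.and ha)).mono ?_
      rintro e ⟨y, ⟨hy, hay⟩, hy'⟩
      refine ⟨y, hy, fun l => ?_⟩
      induction l using Fin.lastCases with
      | last => simpa [hl] using hay
      | cast l => simpa using hy' l
    · obtain ⟨y, hy, hy'⟩ := (hW.and h').exists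
      refine (eventually_power_forall D hy' (n + 1)).mono fun e he => ⟨y, hy, fun l => ?_⟩
      refine iff_of_false (he l) fun hηl => hl ?_
      have := hη (Fin.le_last l)
      rw [hηl] at this
      exact top_le_iff.1 this

end Powers

/-! ### Symmetric ultrafilters, averages and average sequences -/

section Averages

variable {L : FirstOrder.Language.{u, v}} {C : Type w} [L.Structure C]
variable {M : L.ElementarySubstructure C} {m : ℕ}

/-- The powers of `D` are invariant under permutations, as far as formulas are concerned. -/
def IsSymmetric (D : Ultrafilter (Fin m → M)) : Prop :=
  ∀ (n : ℕ) (φ : L.Formula (Fin n × Fin m)) (σ : Equiv.Perm (Fin n)),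
    (∀ᶠ e : Fin n → Fin m → M in ultrafilterPower D n, φ.Realize fun q => (e q.1 q.2 : C)) ↔
      ∀ᶠ e : Fin n → Fin m → M in ultrafilterPower D n, φ.Realize fun q => (e (σ q.1) q.2 : C)

theorem mem_average_withParams {B : Set C} {γ : Type*} (D : Ultrafilter (Fin m → M))
    (φ : L.Formula (γ ⊕ Fin m)) (d : γ → B) :
    (BoundedFormula.constantsVarsEquiv.symm (φ.relabel (Sum.map d id)) : L[[B]].Formula (Fin m)) ∈
      average B D ↔
    ∀ᶠ a in (D : Filter (Fin m → M)),
      φ.Realize (Sum.elim (fun j => (d j : C)) fun i => (a i : C)) := by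
  refine eventually_congr (Eventually.of_forall fun a => ?_)
  refine (realize_withParams _ _).trans ?_
  rw [Formula.realize_relabel, Sum.elim_comp_map]
  rfl

theorem mem_tp_withParams {B : Set C} {γ : Type*}
    (φ : L.Formula (γ ⊕ Fin m)) (d : γ → B) (b : Fin m → C) :
    (BoundedFormula.constantsVarsEquiv.symm (φ.relabel (Sum.map d id)) : L[[B]].Formula (Fin m)) ∈
      tp L B b ↔ φ.Realize (Sum.elim (fun j => (d j : C)) b) := by
  refine (realize_withParams _ _).trans ?_
  rw [Formula.realize_relabel, Sum.elim_comp_map]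
  rfl

theorem realize_constantsVarsEquiv_iff {B : Set C} {β : Type*} (φ : L[[B]].Formula β) (v : β → C) :
    Formula.Realize (BoundedFormula.constantsVarsEquiv φ : L.Formula (B ⊕ β))
      (Sum.elim (fun a : B => (a : C)) v) ↔ φ.Realize v :=
  BoundedFormula.realize_constantsVarsEquiv

/-- A tuple realizes the average of `D` over `B` if it satisfies the right formulas. -/
theorem tp_eq_average {B : Set C} {D : Ultrafilter (Fin m → M)} {b : Fin m → C}
    (h : ∀ φ : L.Formula (B ⊕ Fin m), φ.Realize (Sum.elim (fun a : B => (a : C)) b) ↔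
      ∀ᶠ a in (D : Filter (Fin m → M)),
        φ.Realize (Sum.elim (fun a : B => (a : C)) fun i => (a i : C))) :
    tp L B b = average B D := by
  ext φ
  change φ.Realize b ↔ ∀ᶠ a in (D : Filter (Fin m → M)), φ.Realize fun i => (a i : C)
  rw [← realize_constantsVarsEquiv_iff, h]
  exact eventually_congr (Eventually.of_forall fun a => realize_constantsVarsEquiv_iff _ _)

/-- In a NIP structure a symmetric ultrafilter commutes with every ultrafilter. -/
theorem IsSymmetric.eventually_comm_of [Nonempty C] (hNIP : IsNIP L C) {D : Ultrafilter (Fin m → M)}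
    (hD : IsSymmetric D) {γ : Type} [Finite γ] (E : Ultrafilter (γ → M))
    (θ : L.Formula (Fin m ⊕ γ))
    (h : ∀ᶠ a : Fin m → M in D, ∀ᶠ y : γ → M in E,
      θ.Realize (Sum.elim (fun i => (a i : C)) fun j => (y j : C))) :
    ∀ᶠ y : γ → M in E, ∀ᶠ a : Fin m → M in D,
      θ.Realize (Sum.elim (fun i => (a i : C)) fun j => (y j : C)) := by
  by_contra hcon
  rw [← Ultrafilter.eventually_not] at hcon
  simp only [← Ultrafilter.eventually_not] at hcon
  obtain ⟨n, hn⟩ := hNIP.exists_pattern (θ.relabel (Sum.swap : Fin m ⊕ γ → γ ⊕ Fin m))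
  have key : ∀ η : Fin n → Bool, ∀ᶠ e : Fin n → Fin m → M in ultrafilterPower D n, ∃ y : γ → C, ∀ l,
      θ.Realize (Sum.elim (fun i => (e l i : C)) y) ↔ η l = true := by
    -- The sorted pattern appears on the power of `D`; its consistency is a first-order property of
    -- the tuple, so symmetry carries it to the unsorted pattern.
    intro η
    have h1 := eventually_power_pattern D E _ h hcon n (η ∘ Tuple.sort η) (Tuple.monotone_sort η)
      (fun _ => True) (Eventually.of_forall fun _ => trivial)
    let χ : L.Formula (Fin n × Fin m) := patternFormula
      (θ.relabel (Sum.swap : Fin m ⊕ γ → γ ⊕ Fin m)) (fun l i => (l, i)) (η ∘ Tuple.sort η)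
    have hχ : ∀ e : Fin n → Fin m → C, χ.Realize (fun q => e q.1 q.2) ↔
        ∃ y : γ → C, ∀ l, θ.Realize (Sum.elim (e l) y) ↔ η (Tuple.sort η l) = true := by
      intro e
      simp only [χ, realize_patternFormula, Formula.realize_relabel]
      refine exists_congr fun y => forall_congr' fun l => iff_of_eq ?_
      congr 2
      funext i; rcases i with i | i <;> rfl
    have h2 := (hD n χ (Tuple.sort η)).1 (h1.mono fun e ⟨y, _, hy⟩ =>
      (hχ fun l i => (e l i : C)).2 ⟨fun j => (y j : C), hy⟩)
    refine h2.mono fun e he => ?_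
    obtain ⟨y, hy⟩ := (hχ fun l i => (e (Tuple.sort η l) i : C)).1 he
    exact ⟨y, fun l => by simpa using hy ((Tuple.sort η).symm l)⟩
  -- There are finitely many patterns, so a single tuple `e` shows all of them.
  obtain ⟨e, he⟩ := (eventually_all.2 key).exists
  obtain ⟨η, hη⟩ := hn fun l i => (e l i : C)
  obtain ⟨y, hy⟩ := he η
  refine hη y fun l => ?_
  rw [← hy l, Formula.realize_relabel]
  refine iff_of_eq (congrArg _ ?_)
  funext i; rcases i with i | i <;> rfl

theorem IsSymmetric.eventually_comm [Nonempty C] (hNIP : IsNIP L C) {D : Ultrafilter (Fin m → M)}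
    (hD : IsSymmetric D) {γ : Type} [Finite γ] (E : Ultrafilter (γ → M))
    (θ : L.Formula (Fin m ⊕ γ)) :
    (∀ᶠ a : Fin m → M in D, ∀ᶠ y : γ → M in E,
      θ.Realize (Sum.elim (fun i => (a i : C)) fun j => (y j : C))) ↔
    ∀ᶠ y : γ → M in E, ∀ᶠ a : Fin m → M in D,
      θ.Realize (Sum.elim (fun i => (a i : C)) fun j => (y j : C)) := by
  refine ⟨hD.eventually_comm_of hNIP E θ, fun h => ?_⟩
  by_contra hcon
  simp only [← Ultrafilter.eventually_not] at hcon
  have := hD.eventually_comm_of hNIP E (∼θ) hcon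
  obtain ⟨y, hy, hy'⟩ := (h.and this).exists
  obtain ⟨a, ha, ha'⟩ := (hy.and hy').exists
  exact ha' ha

/-- If `D'` is symmetric and has the same average as `D` over `M`, then the powers of `D` and of
`D'` have the same averages over `M`. -/
theorem eventually_power_congr [Nonempty C] (hNIP : IsNIP L C) {D D' : Ultrafilter (Fin m → M)}
    (hD' : IsSymmetric D') (h : average (M : Set C) D = average (M : Set C) D') (n : ℕ) :
    ∀ {γ : Type} [Finite γ] (φ : L.Formula (γ ⊕ Fin n × Fin m)) (d : γ → M),
      (∀ᶠ e : Fin n → Fin m → M in ultrafilterPower D n,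
        φ.Realize (Sum.elim (fun j => (d j : C)) fun q => (e q.1 q.2 : C))) ↔
      ∀ᶠ e : Fin n → Fin m → M in ultrafilterPower D' n,
        φ.Realize (Sum.elim (fun j => (d j : C)) fun q => (e q.1 q.2 : C)) := by
  induction n with
  | zero => intro γ _ φ d; rfl
  | succ n ih =>
    intro γ _ φ d
    -- `φ` with the variables grouped as needed for averages, commutation and induction
    let φ₁ : L.Formula ((γ ⊕ Fin n × Fin m) ⊕ Fin m) := φ.relabel (Sum.elim
      (fun j => Sum.inl (Sum.inl j)) fun q =>
        (Fin.cons (fun i => Sum.inr i) (fun l i => Sum.inl (Sum.inr (l, i))) :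
          Fin (n + 1) → Fin m → (γ ⊕ Fin n × Fin m) ⊕ Fin m) q.1 q.2)
    have hφ₁ : ∀ (a : Fin m → M) (e : Fin n → Fin m → M),
        φ.Realize (Sum.elim (fun j => (d j : C)) fun q =>
          ((Fin.cons a e : Fin (n + 1) → Fin m → M) q.1 q.2 : C)) ↔
        φ₁.Realize (Sum.elim (Sum.elim (fun j => (d j : C)) fun q => (e q.1 q.2 : C))
          fun i => (a i : C)) := by
      intro a e
      rw [Formula.realize_relabel]
      refine iff_of_eq (congrArg _ ?_)
      funext q
      rcases q with j | ⟨l, i⟩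
      · rfl
      · induction l using Fin.cases <;> simp
    have hswap : ∀ (a : Fin m → M) (y : γ ⊕ Fin n × Fin m → M),
        (φ₁.relabel (Sum.swap : _ → Fin m ⊕ (γ ⊕ Fin n × Fin m))).Realize
          (Sum.elim (fun i => (a i : C)) fun j => (y j : C)) ↔
        φ₁.Realize (Sum.elim (fun j => (y j : C)) fun i => (a i : C)) := by
      intro a y
      rw [Formula.realize_relabel]
      exact iff_of_eq (congrArg _ (by funext q; rcases q with q | q <;> rfl))
    have havg : ∀ y : γ ⊕ Fin n × Fin m → M,
        (∀ᶠ a : Fin m → M in D,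
          φ₁.Realize (Sum.elim (fun j => (y j : C)) fun i => (a i : C))) ↔
        ∀ᶠ a : Fin m → M in D',
          φ₁.Realize (Sum.elim (fun j => (y j : C)) fun i => (a i : C)) := by
      intro y
      rw [← mem_average_withParams (B := (M : Set C)) D φ₁ (fun j => ⟨y j, (y j).2⟩), h,
        mem_average_withParams]
    have hsum : ∀ e : Fin n → Fin m → M,
        (Sum.elim (fun j => (d j : C)) fun q : Fin n × Fin m => (e q.1 q.2 : C)) =
        fun j => (((Sum.elim d fun q => e q.1 q.2) j : M) : C) := by
      intro e; funext q; rcases q with q | q <;> rfl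
    have hcomm : ∀ D₀ : Ultrafilter (Fin m → M),
        (∀ᶠ e : Fin n → Fin m → M in ultrafilterPower D₀ n, ∀ᶠ a : Fin m → M in D',
          φ₁.Realize (Sum.elim (Sum.elim (fun j => (d j : C)) fun q => (e q.1 q.2 : C))
            fun i => (a i : C))) ↔
        ∀ᶠ a : Fin m → M in D', ∀ᶠ e : Fin n → Fin m → M in ultrafilterPower D₀ n,
          φ₁.Realize (Sum.elim (Sum.elim (fun j => (d j : C)) fun q => (e q.1 q.2 : C))
            fun i => (a i : C)) := by
      intro D₀
      have := (hD'.eventually_comm hNIP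
        ((ultrafilterPower D₀ n).map fun e => Sum.elim d fun q => e q.1 q.2)
        (φ₁.relabel (Sum.swap : _ → Fin m ⊕ (γ ⊕ Fin n × Fin m)))).symm
      simp only [hswap, Ultrafilter.coe_map, eventually_map] at this
      simpa only [hsum] using this
    let φ₂ : L.Formula ((γ ⊕ Fin m) ⊕ Fin n × Fin m) := φ₁.relabel (Sum.elim
      (Sum.map Sum.inl id) fun i => Sum.inl (Sum.inr i))
    have hφ₂ : ∀ (a : Fin m → M) (e : Fin n → Fin m → M),
        φ₁.Realize (Sum.elim (Sum.elim (fun j => (d j : C)) fun q => (e q.1 q.2 : C))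
          fun i => (a i : C)) ↔
        φ₂.Realize (Sum.elim (fun j => (((Sum.elim d a) j : M) : C)) fun q => (e q.1 q.2 : C)) := by
      intro a e
      refine (Formula.realize_relabel.trans (iff_of_eq (congrArg _ ?_))).symm
      funext q
      rcases q with (q | q) | q <;> rfl
    -- With the first coordinate innermost, `D` may be replaced there by `D'`, as all other entries
    -- lie in `M`. Then `D'` is moved outside by commutation, and the induction hypothesis applies
    -- with `a` as an additional parameter.
    rw [eventually_power_succ', eventually_power_succ']
    simp only [hφ₁]
    have h1 : ∀ e : Fin n → Fin m → M, _ := fun e => havg (Sum.elim d fun q => e q.1 q.2)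
    simp only [← hsum] at h1
    simp only [h1]
    rw [hcomm D, hcomm D']
    simp only [hφ₂]
    exact eventually_congr (Eventually.of_forall fun a => ih φ₂ (Sum.elim d a))

/-- This makes symmetry a property of the type over `M`, which is needed because a stable type may
be witnessed by a different ultrafilter. -/
theorem IsSymmetric.of_average_eq [Nonempty C] (hNIP : IsNIP L C) {D D' : Ultrafilter (Fin m → M)}
    (hD' : IsSymmetric D') (h : average (M : Set C) D = average (M : Set C) D') :
    IsSymmetric D := by
  intro n φ σ
  have key : ∀ φ : L.Formula (Fin n × Fin m),
      (∀ᶠ e : Fin n → Fin m → M in ultrafilterPower D n, φ.Realize fun q => (e q.1 q.2 : C)) ↔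
      ∀ᶠ e : Fin n → Fin m → M in ultrafilterPower D' n,
        φ.Realize fun q => (e q.1 q.2 : C) := by
    intro φ
    have := eventually_power_congr hNIP hD' h n
      (φ.relabel (Sum.inr : Fin n × Fin m → Empty ⊕ Fin n × Fin m)) Empty.elim
    simpa only [Formula.realize_relabel, Sum.elim_comp_inr] using this
  have h1 := key (φ.relabel (Prod.map σ id))
  simp only [Formula.realize_relabel] at h1
  exact (key φ).trans ((hD' n φ σ).trans h1.symm)

/-- The formulas over `M` satisfied by increasing tuples in an average sequence of `D` are given by
the powers of `D`. -/
theorem IsAverageSeq.realize_iff {D : Ultrafilter (Fin m → M)} {I : Type x} [LinearOrder I]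
    {b : I → Fin m → C} (hb : IsAverageSeq D b) (n : ℕ) :
    ∀ (s : Fin n → I), StrictMono s → ∀ {γ : Type} (φ : L.Formula (γ ⊕ Fin n × Fin m))
      (d : γ → M), φ.Realize (Sum.elim (fun j => (d j : C)) fun q => b (s q.1) q.2) ↔
      ∀ᶠ e : Fin n → Fin m → M in ultrafilterPower D n,
        φ.Realize (Sum.elim (fun j => (d j : C)) fun q => (e q.1 q.2 : C)) := by
  induction n with
  | zero =>
    intro s _ γ φ d
    rw [eventually_power_zero]
    exact iff_of_eq (congrArg _ (by funext q; rcases q with q | q; exacts [rfl, q.1.elim0]))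
  | succ n ih =>
    intro s hs γ φ d
    let φ₁ : L.Formula ((γ ⊕ Fin n × Fin m) ⊕ Fin m) := φ.relabel (Sum.elim
      (fun j => Sum.inl (Sum.inl j)) fun q =>
        (Fin.snoc (fun l i => Sum.inl (Sum.inr (l, i))) (fun i => Sum.inr i) :
          Fin (n + 1) → Fin m → (γ ⊕ Fin n × Fin m) ⊕ Fin m) q.1 q.2)
    have hφ₁ : ∀ (d : γ → C) (a : Fin m → C) (e : Fin (n + 1) → Fin m → C),
        e (Fin.last n) = a → (φ.Realize (Sum.elim d fun q => e q.1 q.2) ↔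
        φ₁.Realize (Sum.elim (Sum.elim d fun q => e q.1.castSucc q.2) a)) := by
      rintro d _ e rfl
      rw [Formula.realize_relabel]
      refine iff_of_eq (congrArg _ ?_)
      funext q
      rcases q with j | ⟨l, i⟩
      · rfl
      · induction l using Fin.lastCases <;> simp
    let φ₂ : L.Formula ((γ ⊕ Fin m) ⊕ Fin n × Fin m) := φ₁.relabel (Sum.elim
      (Sum.map Sum.inl id) fun i => Sum.inl (Sum.inr i))
    have hφ₂ : ∀ (a : Fin m → M) (e : Fin n × Fin m → C),
        φ₁.Realize (Sum.elim (Sum.elim (fun j => (d j : C)) e) fun i => (a i : C)) ↔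
        φ₂.Realize (Sum.elim (fun j => (((Sum.elim d a) j : M) : C)) e) := by
      intro a e
      refine (Formula.realize_relabel.trans (iff_of_eq (congrArg _ ?_))).symm
      funext q
      rcases q with (q | q) | q <;> rfl
    let B : Set C := (M : Set C) ∪ {a | ∃ t < s (Fin.last n), ∃ i, b t i = a}
    let d' : γ ⊕ Fin n × Fin m → B := Sum.elim (fun j => ⟨d j, Or.inl (d j).2⟩) fun q =>
      ⟨b (s q.1.castSucc) q.2, Or.inr ⟨_, hs (Fin.castSucc_lt_last _), _, rfl⟩⟩
    have hd' : (fun j => (d' j : C)) =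
        Sum.elim (fun j => (d j : C)) fun q => b (s q.1.castSucc) q.2 := by
      funext q; rcases q with q | q <;> rfl
    -- The last entry realizes the average over `M` and the earlier entries, so it can be exchanged
    -- for a `D`-typical `a` in `M`; then the induction hypothesis treats the earlier entries with
    -- `a` as a parameter.
    have h1 := mem_tp_withParams φ₁ d' (b (s (Fin.last n)))
    rw [hb (s (Fin.last n)), mem_average_withParams, hd'] at h1
    rw [hφ₁ _ _ (fun l => b (s l)) rfl, ← h1, eventually_power_succ]
    refine eventually_congr (Eventually.of_forall fun a => ?_)
    rw [hφ₂, ih (fun l => s l.castSucc) (hs.comp Fin.strictMono_castSucc)]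
    refine eventually_congr (Eventually.of_forall fun e => ?_)
    rw [← hφ₂]
    have := hφ₁ (fun j => (d j : C)) (fun i => (a i : C))
      (fun l i => ((Fin.snoc e a : Fin (n + 1) → Fin m → M) l i : C)) (by funext i; simp)
    simp only [Fin.snoc_castSucc] at this
    exact this.symm

/-- An average sequence is indiscernible. -/
theorem IsAverageSeq.isIndiscernibleSeq {D : Ultrafilter (Fin m → M)} {I : Type x} [LinearOrder I]
    {b : I → Fin m → C} (hb : IsAverageSeq D b) : IsIndiscernibleSeq L b := by
  intro n φ s t hs ht
  have key : ∀ s : Fin n → I, StrictMono s → _ := fun s hs => hb.realize_iff n s hs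
    (φ.relabel (Sum.inr : Fin n × Fin m → Empty ⊕ Fin n × Fin m)) Empty.elim
  simp only [Formula.realize_relabel, Sum.elim_comp_inr] at key
  rw [key s hs, key t ht]

/-- If some infinite average sequence of `D` is an indiscernible set, then `D` is symmetric. -/
theorem IsAverageSeq.isSymmetric {D : Ultrafilter (Fin m → M)} {I : Type x} [LinearOrder I]
    [Infinite I] {b : I → Fin m → C} (hb : IsAverageSeq D b) (hset : IsIndiscernibleSet L b) :
    IsSymmetric D := by
  intro n φ σ
  obtain ⟨S, hS⟩ := Infinite.exists_subset_card_eq I n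
  let s : Fin n → I := fun j => S.orderIsoOfFin hS j
  have hs : StrictMono s := (S.orderIsoOfFin hS).strictMono
  have key : ∀ φ : L.Formula (Fin n × Fin m), _ := fun φ => hb.realize_iff n s hs
    (φ.relabel (Sum.inr : Fin n × Fin m → Empty ⊕ Fin n × Fin m)) Empty.elim
  simp only [Formula.realize_relabel, Sum.elim_comp_inr] at key
  have h1 := key (φ.relabel (Prod.map σ id))
  simp only [Formula.realize_relabel] at h1
  rw [← key φ]
  exact (hset n φ s (s ∘ σ) hs.injective (hs.injective.comp σ.injective)).trans h1

theorem IsSaturated.exists_tp_eq_average [Nonempty C] {κ : Cardinal.{w}} (hsat : IsSaturated L C κ)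
    (hκ : ℵ₀ < κ) (D : Ultrafilter (Fin m → M)) (B : Set C) (hB : #B < κ) :
    ∃ b : Fin m → C, tp L B b = average B D := by
  obtain ⟨b, hb⟩ := hsat.exists_realize hκ (fun a : B => (a : C)) hB
    (D.map fun a i => (a i : C))
  exact ⟨b, tp_eq_average hb⟩

/-- Average sequences of order type `ω` exist in sufficiently saturated structures. -/
theorem IsSaturated.exists_isAverageSeq [Nonempty C] {κ : Cardinal.{w}} (hsat : IsSaturated L C κ)
    (hκ : ℵ₀ < κ) (hM : #M < κ) (D : Ultrafilter (Fin m → M)) :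
    ∃ b : ℕ → Fin m → C, IsAverageSeq D b := by
  classical
  let G : (t : ℕ) → ((s : ℕ) → s < t → Fin m → C) → Set C := fun t f =>
    (M : Set C) ∪ {a | ∃ (s : ℕ) (h : s < t), ∃ i, f s h i = a}
  have hG : ∀ t f, #(G t f) < κ := by
    intro t f
    refine (Cardinal.mk_union_le _ _).trans_lt (Cardinal.add_lt_of_lt hκ.le hM ?_)
    have : {a | ∃ (s : ℕ) (h : s < t), ∃ i, f s h i = a} =
        Set.range fun p : Fin t × Fin m => f p.1 p.1.2 p.2 := by
      ext a
      constructor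
      · rintro ⟨s, h, i, rfl⟩; exact ⟨⟨⟨s, h⟩, i⟩, rfl⟩
      · rintro ⟨⟨⟨s, h⟩, i⟩, rfl⟩; exact ⟨s, h, i, rfl⟩
    rw [this]
    exact (Cardinal.lt_aleph0_of_finite _).trans hκ
  choose F hF using fun t f => hsat.exists_tp_eq_average hκ D (G t f) (hG t f)
  let b : ℕ → Fin m → C := WellFounded.fix Nat.lt_wfRel.wf F
  have hbt : ∀ t, b t = F t fun s _ => b s := fun t => WellFounded.fix_eq _ F t
  refine ⟨b, fun t => ?_⟩
  have := hF t fun s _ => b s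
  rw [← hbt] at this
  have hset : G t (fun s _ => b s) = (M : Set C) ∪ {a | ∃ s < t, ∃ i, b s i = a} := by
    ext a
    simp only [G, Set.mem_union, Set.mem_ofPred_eq, exists_prop]
  rwa [hset] at this

end Averages

/-! ### Ramsey's theorem for pairs and the Erdős–Makkai theorem -/

section Combinatorics

/-- Greedy choice: finitely many typical indices leave a large set of typical indices that are
related to all of them and lie beyond them. -/
theorem exists_strictMono_of_eventually (R : ℕ → ℕ → Prop)
    (h : ∀ᶠ i in (hyperfilter ℕ : Filter ℕ), ∀ᶠ n in (hyperfilter ℕ : Filter ℕ), R i n) :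
    ∃ g : ℕ → ℕ, StrictMono g ∧ ∀ i j, i < j → R (g i) (g j) := by
  obtain ⟨g, -, hg⟩ := exists_seq_of_forall_finset_exists
    (fun i => ∀ᶠ n in (hyperfilter ℕ : Filter ℕ), R i n) (fun i n => i < n ∧ R i n) (fun s hs => by
      have h1 : ∀ᶠ n in (hyperfilter ℕ : Filter ℕ), ∀ i ∈ s, i < n :=
        Nat.hyperfilter_le_atTop ((eventually_all_finset s).2 fun i _ => eventually_gt_atTop i)
      obtain ⟨y, hy, hy', hy''⟩ := (h.and (((eventually_all_finset s).2 hs).and h1)).exists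
      exact ⟨y, hy, fun i hi => ⟨hy'' i hi, hy' i hi⟩⟩)
  exact ⟨g, fun i j hij => (hg i j hij).1, fun i j hij => (hg i j hij).2⟩

/-- Ramsey's theorem for pairs and two colours. -/
theorem exists_homogeneous (R : ℕ → ℕ → Prop) :
    ∃ g : ℕ → ℕ, StrictMono g ∧
      ((∀ i j, i < j → R (g i) (g j)) ∨ ∀ i j, i < j → ¬ R (g i) (g j)) := by
  by_cases h : ∀ᶠ i in (hyperfilter ℕ : Filter ℕ), ∀ᶠ n in (hyperfilter ℕ : Filter ℕ), R i n
  · obtain ⟨g, hg, hR⟩ := exists_strictMono_of_eventually R h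
    exact ⟨g, hg, Or.inl hR⟩
  · simp only [← Ultrafilter.eventually_not] at h
    obtain ⟨g, hg, hR⟩ := exists_strictMono_of_eventually _ h
    exact ⟨g, hg, Or.inr hR⟩

variable {X : Type u}

theorem mk_finset_le_of_aleph0_le {μ : Cardinal.{u}} (hμ : ℵ₀ ≤ μ) (hX : #X ≤ μ) :
    #(Finset X) ≤ μ := by
  classical
  exact (Cardinal.mk_le_of_surjective List.toFinset_surjective).trans
    ((Cardinal.mk_list_le_max X).trans (max_le hμ hX))

/-- A family of more than `μ` sets has a member that is not a Boolean combination of finitely many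
members of a given subfamily of size at most `μ`. -/
theorem exists_not_boolean_combination {μ : Cardinal.{u}} (hμ : ℵ₀ ≤ μ)
    (F F' : Set (Set X)) (hF : μ < #F) (hF' : #F' ≤ μ) :
    ∃ S ∈ F, ∀ T : Finset F', ∃ a ∈ S, ∃ b ∉ S, ∀ S' ∈ T, a ∈ S'.1 ↔ b ∈ S'.1 := by
  by_contra! hcon
  choose T hT using hcon
  let pat : (S : F) → X → Set (T S.1 S.2) := fun S x => {S' | x ∈ S'.1.1}
  -- If `T` separates the points of `S` from those outside, then `S` is determined by `T` and the
  -- finite set of `T`-patterns of its points. There are at most `μ` such data.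
  let f : F → Σ T : Finset F', Set (Set T) := fun S => ⟨T S.1 S.2, pat S '' S.1⟩
  have hf : Function.Injective f := by
    have key : ∀ S S' : F, f S = f S' → S.1 ⊆ S'.1 := by
      intro S S' h a ha
      let rel : (Σ T : Finset F', Set (Set T)) → Prop := fun t => {S'' : t.1 | a ∈ S''.1.1} ∈ t.2
      have h1 : rel (f S) := ⟨a, ha, rfl⟩
      rw [h] at h1
      obtain ⟨x, hx, hxa⟩ := h1
      by_contra haS
      obtain ⟨S'', hS'', hne⟩ := hT S'.1 S'.2 x hx a haS
      have h2 : x ∈ S''.1 ↔ a ∈ S''.1 :=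
        Set.ext_iff.1 hxa (⟨S'', hS''⟩ : T S'.1 S'.2)
      tauto
    exact fun S S' h => Subtype.ext ((key S S' h).antisymm (key S' S h.symm))
  have h1 := Cardinal.mk_le_of_injective hf
  rw [Cardinal.mk_sigma] at h1
  have h2 : Cardinal.sum (fun T : Finset F' => #(Set (Set T))) ≤ Cardinal.sum fun _ : Finset F' => ℵ₀ :=
    Cardinal.sum_le_sum _ _ fun T => (Cardinal.lt_aleph0_of_finite _).le
  rw [Cardinal.sum_const'] at h2
  exact (hF.trans_le (h1.trans (h2.trans (Cardinal.mul_le_of_le hμ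
    (mk_finset_le_of_aleph0_le hμ hF') hμ)))).false

/-- The Erdős–Makkai theorem. -/
theorem exists_order_of_many_sets {μ : Cardinal.{u}} (hμ : ℵ₀ ≤ μ) (hX : #X ≤ μ) (F : Set (Set X))
    (hF : μ < #F) : ∃ (a : ℕ → X) (S : ℕ → Set X), (∀ i, S i ∈ F) ∧
      ((∀ i j, a j ∈ S i ↔ i < j) ∨ ∀ i j, a j ∈ S i ↔ j ≤ i) := by
  classical
  let sep : Finset X × Finset X → Set X → Prop := fun p S => (∀ a ∈ p.1, a ∈ S) ∧ ∀ b ∈ p.2, b ∉ S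
  obtain ⟨S₀, hS₀⟩ : F.Nonempty := by
    rw [Set.nonempty_iff_ne_empty]
    rintro rfl
    simp at hF
  -- One chosen member of `F` for each separable pair of finite sets; `S₀` is a default value. Only
  -- `μ` members are chosen, so some `S'` in `F` is not a Boolean combination of finitely many of
  -- them.
  let G : Finset X × Finset X → Set X := fun p =>
    if h : ∃ S ∈ F, sep p S then h.choose else S₀
  have hG : ∀ p, (∃ S ∈ F, sep p S) → sep p (G p) := fun p h => by
    simp only [G, dif_pos h]; exact h.choose_spec.2
  have hGF : ∀ p, G p ∈ F := fun p => by
    by_cases h : ∃ S ∈ F, sep p S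
    · simp only [G, dif_pos h]; exact h.choose_spec.1
    · simp only [G, dif_neg h]; exact hS₀
  have hcard : #(Set.range G) ≤ μ := by
    refine Cardinal.mk_range_le.trans ?_
    simp only [Cardinal.mk_prod, Cardinal.lift_id]
    have := mk_finset_le_of_aleph0_le hμ hX
    exact Cardinal.mul_le_of_le hμ this this
  obtain ⟨S', hS'F, hS'⟩ := exists_not_boolean_combination hμ F (Set.range G) hF hcard
  -- Triples `(a, b, S)` are built with `a ∈ S'` and `b ∉ S'` not distinguished by the earlier sets,
  -- and with `S` containing all `a` so far and missing all `b` so far. Ramsey then settles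
  -- membership of later points in earlier sets: if they belong, the `b` are used, otherwise the
  -- `a`.
  obtain ⟨f, hf1, hf2⟩ := exists_seq_of_forall_finset_exists (α := X × X × Set.range G)
    (fun t => t.1 ∈ S' ∧ t.2.1 ∉ S' ∧ t.1 ∈ t.2.2.1 ∧ t.2.1 ∉ t.2.2.1)
    (fun t t' => (t'.1 ∈ t.2.2.1 ↔ t'.2.1 ∈ t.2.2.1) ∧ t.1 ∈ t'.2.2.1 ∧ t.2.1 ∉ t'.2.2.1)
    (fun s hs => by
      obtain ⟨a, ha, b, hb, hab⟩ := hS' (s.image fun t => t.2.2)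
      have hsep := hG (insert a (s.image fun t => t.1), insert b (s.image fun t => t.2.1))
        ⟨S', hS'F, by
          refine ⟨fun c hc => ?_, fun c hc => ?_⟩
          · rcases Finset.mem_insert.1 hc with rfl | hc
            · exact ha
            · obtain ⟨t, ht, rfl⟩ := Finset.mem_image.1 hc
              exact (hs t ht).1
          · rcases Finset.mem_insert.1 hc with rfl | hc
            · exact hb
            · obtain ⟨t, ht, rfl⟩ := Finset.mem_image.1 hc
              exact (hs t ht).2.1⟩
      refine ⟨(a, b, ⟨_, _, rfl⟩), ⟨ha, hb, hsep.1 a (Finset.mem_insert_self _ _),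
        hsep.2 b (Finset.mem_insert_self _ _)⟩, fun t ht =>
        ⟨hab _ (Finset.mem_image_of_mem _ ht),
          hsep.1 _ (Finset.mem_insert_of_mem (Finset.mem_image_of_mem _ ht)),
          hsep.2 _ (Finset.mem_insert_of_mem (Finset.mem_image_of_mem _ ht))⟩⟩)
  have hF' : ∀ n, (f n).2.2.1 ∈ F := fun n => by
    obtain ⟨p, hp⟩ := (f n).2.2.2
    rw [← hp]; exact hGF p
  obtain ⟨g, hg, hR | hR⟩ := exists_homogeneous fun i j => (f j).1 ∈ (f i).2.2.1
  · refine ⟨fun n => (f (g n)).2.1, fun n => (f (g n)).2.2.1, fun n => hF' _, Or.inl ?_⟩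
    intro i j
    rcases lt_trichotomy i j with h | rfl | h
    · exact iff_of_true ((hf2 _ _ (hg h)).1.1 (hR i j h)) h
    · exact iff_of_false (hf1 _).2.2.2 (lt_irrefl _)
    · exact iff_of_false (hf2 _ _ (hg h)).2.2 h.not_gt
  · refine ⟨fun n => (f (g n)).1, fun n => (f (g n)).2.2.1, fun n => hF' _, Or.inr ?_⟩
    intro i j
    rcases lt_trichotomy i j with h | rfl | h
    · exact iff_of_false (hR i j h) h.not_ge
    · exact iff_of_true (hf1 _).2.2.1 le_rfl
    · exact iff_of_true (hf2 _ _ (hg h)).2.1 h.le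

end Combinatorics

/-! ### Counting types: instability gives the order property in one variable -/

section Counting

variable {L : FirstOrder.Language.{u, v}}

/-- The formula `φ(x, ȳ)`, with `x` a single variable, has the order property in `C`. -/
def HasOP (C : Type w) [L.Structure C] {k : ℕ} (φ : L.Formula (Fin 1 ⊕ Fin k)) : Prop :=
  ∀ n : ℕ, ∃ (a : Fin n → Fin 1 → C) (c : Fin n → Fin k → C),
    ∀ i j, φ.Realize (Sum.elim (a i) (c j)) ↔ i < j

/-- The complete types of `T` in the variables `β`, as sets of formulas. -/
def semanticTypes (T : L.Theory) (β : Type*) : Set (Set (L.Formula β)) :=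
  {Q | ∃ (N : Theory.ModelType.{u, v, max u v} T) (c : β → N), ∀ φ, φ ∈ Q ↔ φ.Realize c}

/-- Pull back a set of formulas along a map of variables. -/
def comapVars {β γ : Type*} (r : β → γ) (Q : Set (L.Formula γ)) : Set (L.Formula β) :=
  {φ | φ.relabel r ∈ Q}

variable {T : L.Theory}

theorem comapVars_mem {β γ : Type*} (r : β → γ) {Q : Set (L.Formula γ)}
    (hQ : Q ∈ semanticTypes T γ) : comapVars r Q ∈ semanticTypes T β := by
  obtain ⟨N, c, hc⟩ := hQ
  exact ⟨N, c ∘ r, fun φ => (hc _).trans Formula.realize_relabel⟩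

theorem comapVars_comapVars {α β γ : Type*} (r : β → γ) (s : α → β) {Q : Set (L.Formula γ)}
    (hQ : Q ∈ semanticTypes T γ) : comapVars s (comapVars r Q) = comapVars (r ∘ s) Q := by
  obtain ⟨N, c, hc⟩ := hQ
  ext φ
  simp only [comapVars, Set.mem_ofPred_eq, hc, Formula.realize_relabel, Function.comp_assoc]

theorem comapVars_injOn {β γ : Type*} {r : β → γ} (hr : Function.Surjective r) :
    Set.InjOn (comapVars r) (semanticTypes T γ) := by
  intro Q hQ Q' hQ' h
  have key : ∀ Q ∈ semanticTypes T γ, ∀ φ, φ ∈ Q ↔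
      φ.relabel (Function.surjInv hr) ∈ comapVars r Q := by
    rintro Q ⟨N, c, hc⟩ φ
    rw [hc, comapVars, Set.mem_ofPred_eq, hc, Formula.realize_relabel, Formula.realize_relabel,
      Function.comp_assoc, (Function.rightInverse_surjInv hr).comp_eq_id]
    rfl
  ext φ
  rw [key Q hQ, key Q' hQ', h]

theorem exists_fin_vars_sum {α : Type*} (χ : L.Formula (α ⊕ Fin 1)) :
    ∃ (k : ℕ) (φ : L.Formula (Fin 1 ⊕ Fin k)) (f : Fin k → α),
      ∀ (M : Type w) [L.Structure M] (v : α ⊕ Fin 1 → M),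
        χ.Realize v ↔ (φ.relabel (Sum.elim Sum.inr (Sum.inl ∘ f))).Realize v := by
  classical
  obtain ⟨n, ψ, g, hg⟩ := exists_fin_vars.{u, v, w} χ
  let e := Fintype.equivFin {i // (g i).isLeft = true}
  refine ⟨_, ψ.relabel fun i => if h : (g i).isLeft = true then Sum.inr (e ⟨i, h⟩) else Sum.inl 0,
    fun j => (g (e.symm j)).getLeft (e.symm j).2, fun M _ v => ?_⟩
  rw [← hg, Formula.realize_relabel, Formula.realize_relabel]
  refine iff_of_eq (congrArg _ ?_)
  funext i
  simp only [Function.comp]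
  split_ifs with h
  · simp
  · rcases hgi : g i with a | j
    · simp [hgi] at h
    · simp [Subsingleton.elim j 0]

/-- The types may be realized in different models, but the existence of an `x` with a given finite
pattern is a formula in the variables `α`, hence part of their common restriction. So all the
patterns are realized in one model, and completeness of `T` transfers the finite configuration to
`C`. -/
theorem hasOP_of_types (hT : T.IsComplete) (C : Type w) [L.Structure C] [Nonempty C] [C ⊨ T]
    {α : Type*} {k : ℕ} (φ : L.Formula (Fin 1 ⊕ Fin k)) (f : ℕ → Fin k → α)
    (Q : ℕ → Set (L.Formula (α ⊕ Fin 1))) (hQ : ∀ i, Q i ∈ semanticTypes T (α ⊕ Fin 1))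
    (hres : ∀ i j, comapVars Sum.inl (Q i) = comapVars Sum.inl (Q j))
    (h : ∀ i j, φ.relabel (Sum.elim Sum.inr (Sum.inl ∘ f j)) ∈ Q i ↔ i < j) : HasOP C φ := by
  classical
  intro n
  obtain ⟨N, c, hc⟩ := hQ 0
  have hN : ∀ i : ℕ, ∃ x : Fin 1 → N, ∀ j : Fin n,
      φ.Realize (Sum.elim x ((c ∘ Sum.inl) ∘ f j)) ↔ decide (i < j) = true := by
    intro i
    rw [← realize_patternFormula φ (fun (j : Fin n) => f j), ← Formula.realize_relabel, ← hc]
    change patternFormula φ _ _ ∈ comapVars Sum.inl (Q 0)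
    rw [hres 0 i]
    obtain ⟨N', c', hc'⟩ := hQ i
    rw [comapVars, Set.mem_ofPred_eq, hc', Formula.realize_relabel, realize_patternFormula]
    refine ⟨c' ∘ Sum.inr, fun j => ?_⟩
    rw [decide_eq_true_iff, ← h, hc', Formula.realize_relabel]
    refine iff_of_eq (congrArg _ ?_)
    funext q; rcases q with q | q <;> rfl
  choose x hx using hN
  let χ : L.Formula (Fin n × (Fin 1 ⊕ Fin k)) := Formula.iInf fun p : Fin n × Fin n =>
    (signed φ (decide (p.1 < p.2))).relabel
      (Sum.elim (fun q => (p.1, Sum.inl q)) fun q => (p.2, Sum.inr q))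
  have hχ : ∀ (K : Type _) [L.Structure K] (v : Fin n × (Fin 1 ⊕ Fin k) → K), χ.Realize v ↔
      ∀ i j : Fin n, φ.Realize (Sum.elim (fun q => v (i, Sum.inl q)) fun q => v (j, Sum.inr q)) ↔
        i < j := by
    intro K _ v
    simp only [χ, Formula.realize_iInf, Formula.realize_relabel, realize_signed, Prod.forall,
      decide_eq_true_iff]
    refine forall_congr' fun i => forall_congr' fun j => iff_of_eq ?_
    congr 2
    funext q; rcases q with q | q <;> rfl
  have hχ' : ∀ (v : Fin n × (Fin 1 ⊕ Fin k) → C), χ.Realize v ↔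
      ∀ i j : Fin n, φ.Realize (Sum.elim (fun q => v (i, Sum.inl q)) fun q => v (j, Sum.inr q)) ↔
        i < j := by
    intro v
    simp only [χ, Formula.realize_iInf, Formula.realize_relabel, realize_signed, Prod.forall,
      decide_eq_true_iff]
    refine forall_congr' fun i => forall_congr' fun j => iff_of_eq ?_
    congr 2
    funext q; rcases q with q | q <;> rfl
  obtain ⟨v, hv⟩ := (exists_realize_iff hT N C χ).1
    ⟨fun q => Sum.elim (x q.1) (fun r => c (Sum.inl (f q.1 r))) q.2, (hχ N _).2 fun i j =>
      (hx i j).trans (by simp)⟩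
  exact ⟨fun i q => v (i, Sum.inl q), fun j q => v (j, Sum.inr q), (hχ' v).1 hv⟩

theorem mk_formula_le (β : Type) [Countable β] : #(L.Formula β) ≤ max ℵ₀ L.card := by
  have h1 : #(L.Formula β) ≤ #(Σ n, L.BoundedFormula β n) :=
    Cardinal.mk_le_of_injective (f := fun φ => ⟨0, φ⟩) fun φ ψ h => by simpa using h
  refine h1.trans (BoundedFormula.card_le.trans ?_)
  rw [Cardinal.lift_uzero]
  refine max_le (le_max_left _ _) (Cardinal.add_le_of_le (le_max_left _ _) ?_ (le_max_right _ _))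
  exact (Cardinal.lift_le_aleph0.2 (Cardinal.mk_le_aleph0)).trans (le_max_left _ _)

/-- If no formula `φ(x, ȳ)` has the order property, there are few types in one variable. -/
theorem mk_types_one_le (hT : T.IsComplete) (C : Type w) [L.Structure C] [Nonempty C] [C ⊨ T]
    (hOP : ∀ k (φ : L.Formula (Fin 1 ⊕ Fin k)), ¬ HasOP C φ) {α : Type (max u v)}
    (hα : #α ≤ 2 ^ max ℵ₀ L.card) (P : Set (L.Formula α)) :
    #{Q : Set (L.Formula (α ⊕ Fin 1)) | Q ∈ semanticTypes T (α ⊕ Fin 1) ∧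
      comapVars Sum.inl Q = P} ≤ 2 ^ max ℵ₀ L.card := by
  set lam : Cardinal.{max u v} := max ℵ₀ L.card with hlam
  have hlam0 : ℵ₀ ≤ lam := le_max_left _ _
  have hμ : ℵ₀ ≤ (2 : Cardinal.{max u v}) ^ lam := hlam0.trans (Cardinal.cantor lam).le
  set K := {Q : Set (L.Formula (α ⊕ Fin 1)) | Q ∈ semanticTypes T (α ⊕ Fin 1) ∧
      comapVars Sum.inl Q = P}
  let J := Σ k, L.Formula (Fin 1 ⊕ Fin k)
  -- A type is determined by its traces, one for each `φ(x, ȳ)`. Too many traces of one formula give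
  -- the order property by Erdős–Makkai; otherwise the number of types is at most `(2 ^ lam) ^ lam =
  -- 2 ^ lam`.
  let S : (p : J) → K → Set (Fin p.1 → α) := fun p Q =>
    {f | p.2.relabel (Sum.elim Sum.inr (Sum.inl ∘ f)) ∈ Q.1}
  have hS : ∀ p : J, #(Set.range (S p)) ≤ 2 ^ lam := by
    intro p
    by_contra! hcon
    have hX : #(Fin p.1 → α) ≤ 2 ^ lam := by
      rw [Cardinal.mk_arrow, Cardinal.lift_uzero, Cardinal.mk_fin, Cardinal.lift_natCast]
      refine (Cardinal.power_le_power_right hα).trans ?_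
      exact_mod_cast Cardinal.power_nat_le hμ
    obtain ⟨a, S', hS', h⟩ := exists_order_of_many_sets hμ hX _ hcon
    choose Q hQ using hS'
    have hres : ∀ i j, comapVars Sum.inl (Q i).1 = comapVars Sum.inl (Q j).1 := fun i j =>
      (Q i).2.2.trans (Q j).2.2.symm
    rcases h with h | h
    · refine hOP p.1 p.2 (hasOP_of_types hT C p.2 a (fun i => (Q i).1) (fun i => (Q i).2.1) hres ?_)
      intro i j
      rw [← h, ← hQ i]; rfl
    -- In the alternative `j ≤ i` it is the negation that has the order property.
    · refine hOP p.1 (∼p.2) (hasOP_of_types hT C (∼p.2) a (fun i => (Q i).1)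
        (fun i => (Q i).2.1) hres ?_)
      intro i j
      rw [← not_le, ← h, ← hQ i]
      obtain ⟨N, c, hc⟩ := (Q i).2.1
      simp only [S, Set.mem_ofPred_eq, hc, Formula.realize_relabel, Formula.realize_not]
  let F : K → ∀ p : J, Set.range (S p) := fun Q p => ⟨S p Q, Q, rfl⟩
  have hF : Function.Injective F := by
    intro Q Q' h
    refine Subtype.ext (Set.ext fun χ => ?_)
    obtain ⟨k, φ, f, hf⟩ := exists_fin_vars_sum.{u, v, max u v} χ
    have h1 : f ∈ S ⟨k, φ⟩ Q ↔ f ∈ S ⟨k, φ⟩ Q' := by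
      rw [show S ⟨k, φ⟩ Q = S ⟨k, φ⟩ Q' from congrArg Subtype.val (congrFun h ⟨k, φ⟩)]
    obtain ⟨N, c, hc⟩ := Q.2.1
    obtain ⟨N', c', hc'⟩ := Q'.2.1
    simp only [S, Set.mem_ofPred_eq, hc, hc'] at h1
    rw [hc, hc', hf, hf, h1]
  have hJ : #J ≤ lam := by
    rw [Cardinal.mk_sigma]
    refine (Cardinal.sum_le_sum _ (fun _ => lam) fun k => mk_formula_le _).trans ?_
    rw [Cardinal.sum_const, Cardinal.lift_uzero, Cardinal.mk_nat, Cardinal.lift_aleph0]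
    exact Cardinal.mul_le_of_le hlam0 hlam0 le_rfl
  refine (Cardinal.mk_le_of_injective hF).trans ?_
  rw [Cardinal.mk_pi]
  refine (Cardinal.prod_le_prod _ (fun _ => 2 ^ lam) hS).trans ?_
  rw [Cardinal.prod_const', ← Cardinal.power_mul]
  exact Cardinal.power_le_power_left two_ne_zero (Cardinal.mul_le_of_le hlam0 le_rfl hJ)

/-- Variables are added one at a time: a type in `n + 1` variables is a 1-type over `α` and the
first `n` variables, whose restriction is one of at most `2 ^ max ℵ₀ L.card` types. -/
theorem mk_types_le (hT : T.IsComplete) (C : Type w) [L.Structure C] [Nonempty C] [C ⊨ T]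
    (hOP : ∀ k (φ : L.Formula (Fin 1 ⊕ Fin k)), ¬ HasOP C φ) {α : Type (max u v)}
    (hα : #α ≤ 2 ^ max ℵ₀ L.card) (P : Set (L.Formula α)) (n : ℕ) :
    #{Q : Set (L.Formula (α ⊕ Fin n)) | Q ∈ semanticTypes T (α ⊕ Fin n) ∧
      comapVars Sum.inl Q = P} ≤ 2 ^ max ℵ₀ L.card := by
  have hμ : ℵ₀ ≤ (2 : Cardinal.{max u v}) ^ max ℵ₀ L.card :=
    (le_max_left _ _).trans (Cardinal.cantor _).le
  induction n with
  | zero =>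
    refine le_trans ?_ (Cardinal.one_le_aleph0.trans hμ)
    rw [Cardinal.le_one_iff_subsingleton]
    refine ⟨fun Q Q' => Subtype.ext (comapVars_injOn (T := T) (r := Sum.inl) ?_ Q.2.1 Q'.2.1
      (Q.2.2.trans Q'.2.2.symm))⟩
    rintro (a | a)
    · exact ⟨a, rfl⟩
    · exact a.elim0
  | succ n ih =>
    let r : (α ⊕ Fin n) ⊕ Fin 1 → α ⊕ Fin (n + 1) :=
      Sum.elim (Sum.map id Fin.castSucc) fun _ => Sum.inr (Fin.last n)
    have hr : Function.Surjective r := by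
      rintro (a | j)
      · exact ⟨Sum.inl (Sum.inl a), rfl⟩
      · induction j using Fin.lastCases with
        | last => exact ⟨Sum.inr 0, rfl⟩
        | cast j => exact ⟨Sum.inl (Sum.inr j), rfl⟩
    set K := {Q : Set (L.Formula (α ⊕ Fin n)) | Q ∈ semanticTypes T (α ⊕ Fin n) ∧
      comapVars Sum.inl Q = P}
    let A : Set (L.Formula (α ⊕ Fin n)) → Set (Set (L.Formula ((α ⊕ Fin n) ⊕ Fin 1))) := fun P' =>
      {Q | Q ∈ semanticTypes T ((α ⊕ Fin n) ⊕ Fin 1) ∧ comapVars Sum.inl Q = P'}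
    have hA : ∀ P', #(A P') ≤ 2 ^ max ℵ₀ L.card := fun P' => mk_types_one_le hT C hOP (by
      rw [Cardinal.mk_sum, Cardinal.lift_uzero]
      refine Cardinal.add_le_of_le hμ hα ?_
      refine (Cardinal.lift_le_aleph0.2 Cardinal.mk_le_aleph0).trans hμ) P'
    have hunion : #(⋃ P' ∈ K, A P') ≤ 2 ^ max ℵ₀ L.card :=
      (Cardinal.mk_biUnion_le A K).trans
        (Cardinal.mul_le_of_le hμ ih (ciSup_le' fun P' => hA P'))
    refine le_trans ?_ hunion
    refine Cardinal.mk_le_of_injective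
      (f := fun Q => ⟨comapVars r Q.1, Set.mem_biUnion (x := comapVars Sum.inl (comapVars r Q.1))
        ⟨comapVars_mem _ (comapVars_mem _ Q.2.1), ?_⟩ ⟨comapVars_mem _ Q.2.1, rfl⟩⟩) ?_
    · rw [comapVars_comapVars (T := T) _ _ (comapVars_mem _ Q.2.1),
        comapVars_comapVars (T := T) _ _ Q.2.1]
      exact Q.2.2
    · intro Q Q' h
      exact Subtype.ext (comapVars_injOn hr Q.2.1 Q'.2.1 (congrArg Subtype.val h))

/-- Types over a subset of a model are determined by semantic types. -/
theorem exists_semanticType (M : Theory.ModelType.{u, v, max u v} T) (A : Set M) {n : ℕ}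
    (p : TypesOver L n A) :
    ∃ Q ∈ semanticTypes T (A ⊕ Fin n),
      comapVars Sum.inl Q = {φ : L.Formula A | φ.Realize fun a => (a : M)} ∧
      ∀ φ : L[[A]].Formula (Fin n), Formula.equivSentence φ ∈ p ↔
        BoundedFormula.constantsVarsEquiv φ ∈ Q := by
  obtain ⟨N, c, rfl⟩ := Theory.exists_modelType_is_realized_in _ p
  let inst : L.Structure N := (L.lhomWithConstants A).reduct N
  let inst' : (L.lhomWithConstants A).IsExpansionOn N := LHom.isExpansionOn_reduct _ _
  have hN : N ⊨ T := by
    have h1 : (L.lhomWithConstants A).onTheory T ⊆ L[[A]].completeTheory M :=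
      Theory.model_iff_subset_completeTheory.1 ((LHom.onTheory_model _ T).2 inferInstance)
    exact (LHom.onTheory_model (L.lhomWithConstants A) T).1 (Theory.Model.mono N.is_model h1)
  have : Nonempty N := N.nonempty'
  refine ⟨{φ | φ.Realize (Sum.elim (fun a : A => (L.con a : N)) c)},
    ⟨Theory.ModelType.of T N, _, fun φ => Iff.rfl⟩, ?_, fun φ => ?_⟩
  · ext φ
    rw [comapVars, Set.mem_ofPred_eq, Set.mem_ofPred_eq, Set.mem_ofPred_eq, Formula.realize_relabel,
      Sum.elim_comp_inl, ← Formula.realize_equivSentence N φ]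
    have h1 := (completeTheory.isMaximal L[[A]] M).isComplete
    refine (h1.realize_sentence_iff _ N).trans ((h1.realize_sentence_iff _ M).symm.trans ?_)
    exact Formula.realize_equivSentence M φ
  · rw [Theory.CompleteType.formula_mem_typeOf]
    exact BoundedFormula.realize_constantsVarsEquiv.symm

/-- Without the order property `T` would be stable in `2 ^ max ℵ₀ L.card`. -/
theorem exists_hasOP_of_not_isStable (hT : T.IsComplete) (C : Type w) [L.Structure C] [Nonempty C]
    [C ⊨ T] (h : ¬ IsStable T) : ∃ (k : ℕ) (φ : L.Formula (Fin 1 ⊕ Fin k)), HasOP C φ := by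
  by_contra! hOP
  refine h ⟨2 ^ max ℵ₀ L.card, (le_max_left _ _).trans (Cardinal.cantor _).le, ?_⟩
  intro M A hA n
  choose Q hQ1 hQ2 hQ3 using fun p : TypesOver L n A => exists_semanticType M A p
  refine le_trans ?_ (mk_types_le hT C hOP hA {φ : L.Formula A | φ.Realize fun a => (a : M)} n)
  refine Cardinal.mk_le_of_injective (f := fun p => ⟨Q p, hQ1 p, hQ2 p⟩) ?_
  intro p p' hpp
  refine SetLike.ext fun σ => ?_
  have := hQ3 p (Formula.equivSentence.symm σ)
  rw [show Q p = Q p' from congrArg Subtype.val hpp, ← hQ3] at this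
  simpa using this

end Counting

/-! ### Nonsymmetric ultrafilters, stretching, and chains of elements -/

section Main

variable {L : FirstOrder.Language.{u, v}} {C : Type w} [L.Structure C]

/-- Small elementary substructures containing a given countable set. -/
theorem exists_small_elementarySubstructure {κ : Cardinal.{w}}
    (hκ : Cardinal.lift.{w} (max ℵ₀ L.card) < Cardinal.lift.{max u v} κ) (S : Set C)
    (hS : S.Countable) : ∃ M : L.ElementarySubstructure C, S ⊆ M ∧ #M < κ := by
  -- `κ'` is `max ℵ₀ L.card` brought into the universe of `C`. Löwenheim–Skolem applies at this size
  -- unless `C` is itself smaller than `κ`.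
  obtain ⟨κ', hκ', h⟩ := Cardinal.lt_lift_iff.1 hκ
  by_cases hC : #C < κ
  · refine ⟨⊤, fun _ _ => trivial, ?_⟩
    exact (Cardinal.mk_le_of_injective Subtype.val_injective).trans_lt hC
  · have h0 : ℵ₀ ≤ κ' := by
      rw [← Cardinal.aleph0_le_lift.{w, max u v}, h, Cardinal.aleph0_le_lift]
      exact le_max_left _ _
    obtain ⟨M, hM, hMc⟩ := exists_elementarySubstructure_card_eq L S κ' h0
      (Cardinal.lift_le.2 (hS.le_aleph0.trans h0))
      (by rw [h]; exact Cardinal.lift_le.2 (le_max_right _ _))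
      (Cardinal.lift_le.2 (hκ'.le.trans (not_lt.1 hC)))
    exact ⟨M, hM, (Cardinal.lift_inj.1 hMc).trans_lt hκ'⟩

variable [Nonempty C]

theorem formulas_typeOf {m : ℕ} (B : Set C) (b : Fin m → C) :
    TypesOver.formulas (L := L) ((L[[B]].completeTheory C).typeOf b) = tp L B b :=
  Set.ext fun _ =>
    Theory.CompleteType.formula_mem_typeOf (T := L[[B]].completeTheory C)

theorem HasOP.exists_seq {κ : Cardinal.{w}} (hsat : IsSaturated L C κ) (hκ : ℵ₀ < κ) {k : ℕ}
    {φ : L.Formula (Fin 1 ⊕ Fin k)} (h : HasOP C φ) :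
    ∃ (a : ℕ → Fin 1 → C) (c : ℕ → Fin k → C),
      ∀ i j, φ.Realize (Sum.elim (a i) (c j)) ↔ i < j := by
  classical
  choose a c hac using h
  -- The `n`-th finite configuration, padded arbitrarily. Each instance of `φ` eventually has the
  -- right truth value, so a realization of the limit type is an infinite configuration.
  let f : ℕ → ℕ × (Fin 1 ⊕ Fin k) → C := fun n p =>
    if h : p.1 < n then Sum.elim (a n ⟨p.1, h⟩) (c n ⟨p.1, h⟩) p.2 else Classical.arbitrary C
  obtain ⟨v, hv⟩ := hsat.exists_realize hκ (fun q : PEmpty.{w + 1} => q.elim)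
    (by simpa using Cardinal.aleph0_pos.trans hκ) ((hyperfilter ℕ).map f)
  refine ⟨fun i q => v (i, Sum.inl q), fun j q => v (j, Sum.inr q), fun i j => ?_⟩
  let ρ : Fin 1 ⊕ Fin k → PEmpty.{w + 1} ⊕ ℕ × (Fin 1 ⊕ Fin k) :=
    Sum.elim (fun q => Sum.inr (i, Sum.inl q)) fun q => Sum.inr (j, Sum.inr q)
  have hρ : ∀ u : ℕ × (Fin 1 ⊕ Fin k) → C,
      (φ.relabel ρ).Realize (Sum.elim (fun q : PEmpty.{w + 1} => q.elim) u) ↔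
        φ.Realize (Sum.elim (fun q => u (i, Sum.inl q)) fun q => u (j, Sum.inr q)) := by
    intro u
    rw [Formula.realize_relabel]
    refine iff_of_eq (congrArg _ ?_)
    funext q; rcases q with q | q <;> rfl
  rw [← hρ, hv, Ultrafilter.coe_map, eventually_map]
  have hlarge : ∀ᶠ n in (hyperfilter ℕ : Filter ℕ), i < n ∧ j < n :=
    Nat.hyperfilter_le_atTop ((eventually_gt_atTop i).and (eventually_gt_atTop j))
  have hiff : ∀ᶠ n in (hyperfilter ℕ : Filter ℕ),
      ((φ.relabel ρ).Realize (Sum.elim (fun q : PEmpty.{w + 1} => q.elim) (f n)) ↔ i < j) := by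
    refine hlarge.mono fun n hn => ?_
    rw [hρ]
    simpa [f, hn.1, hn.2] using hac n ⟨i, hn.1⟩ ⟨j, hn.2⟩
  rw [eventually_congr hiff, eventually_const]

/-- A formula `φ(x, ȳ)` with the order property yields an ultrafilter on single elements of a small
model that is not symmetric. -/
theorem exists_not_isSymmetric {κ : Cardinal.{w}}
    (hκ : Cardinal.lift.{w} (max ℵ₀ L.card) < Cardinal.lift.{max u v} κ)
    (hNIP : IsNIP L C) {k : ℕ} (φ : L.Formula (Fin 1 ⊕ Fin k)) (a : ℕ → Fin 1 → C)
    (c : ℕ → Fin k → C) (h : ∀ i j, φ.Realize (Sum.elim (a i) (c j)) ↔ i < j) :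
    ∃ M : L.ElementarySubstructure C, #M < κ ∧
      ∃ D : Ultrafilter (Fin 1 → M), ¬ IsSymmetric D := by
  obtain ⟨M, hM, hMc⟩ := exists_small_elementarySubstructure hκ
    ((Set.range fun p : ℕ × Fin 1 => a p.1 p.2) ∪ Set.range fun p : ℕ × Fin k => c p.1 p.2)
    ((Set.countable_range _).union (Set.countable_range _))
  let a' : ℕ → Fin 1 → M := fun i q => ⟨a i q, hM (Or.inl ⟨(i, q), rfl⟩)⟩
  let c' : ℕ → Fin k → M := fun i q => ⟨c i q, hM (Or.inr ⟨(i, q), rfl⟩)⟩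
  -- Commutation with the limit of the `c j` fails: for each `i` most `j` satisfy `i < j`, while for
  -- each `j` most `i` do not.
  refine ⟨M, hMc, (hyperfilter ℕ).map a', fun hD => ?_⟩
  have h1 := hD.eventually_comm_of hNIP ((hyperfilter ℕ).map c') φ
  simp only [Ultrafilter.coe_map, eventually_map, a', c', h] at h1
  have h2 := h1 (Eventually.of_forall fun i =>
    Nat.hyperfilter_le_atTop (eventually_gt_atTop i))
  obtain ⟨j, hj⟩ := h2.exists
  have h3 : ∀ᶠ i in (hyperfilter ℕ : Filter ℕ), j < i :=
    Nat.hyperfilter_le_atTop (eventually_gt_atTop j)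
  obtain ⟨i, hi, hi'⟩ := (hj.and h3).exists
  exact hi.not_gt hi'

theorem not_isStableType_of_not_isSymmetric (hNIP : IsNIP L C) {M : L.ElementarySubstructure C}
    {m : ℕ} {D : Ultrafilter (Fin m → M)} (hD : ¬ IsSymmetric D)
    (p : TypesOver L m (M : Set C)) (hp : p.formulas = average (M : Set C) D) :
    ¬ IsStableType p := by
  rintro ⟨D', hD', I, hI, hI', b, hb, hset⟩
  exact hD ((hb.isSymmetric hset).of_average_eq hNIP (hp.symm.trans hD'.symm))

/-- An indiscernible sequence of order type `ω` can be stretched to one indexed by `ℚ`. -/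
theorem IsSaturated.exists_stretch {κ : Cardinal.{w}} (hsat : IsSaturated L C κ) (hκ : ℵ₀ < κ)
    {m : ℕ} {b : ℕ → Fin m → C} (hb : IsIndiscernibleSeq L b) (hnb : ¬ IsIndiscernibleSet L b) :
    ∃ b' : ℚ → Fin m → C, IsIndiscernibleSeq L b' ∧ ¬ IsIndiscernibleSet L b' := by
  classical
  obtain ⟨g, hg⟩ := Countable.exists_injective_nat ℚ
  let F : ℕ → Finset ℚ := fun n => (Finset.range n).preimage g hg.injOn
  -- The number of rationals below `q` among those coded below `n`. For large `n` this preserves the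
  -- order of any given finite set of rationals, so the limit of the sequences `b ∘ rk n` looks like
  -- `b` on finite tuples.
  let rk : ℕ → ℚ → ℕ := fun n q => ((F n).filter (· < q)).card
  have hrk : ∀ n q q', q ∈ F n → q < q' → rk n q < rk n q' := by
    intro n q q' hq hqq'
    refine Finset.card_lt_card ⟨fun r hr => ?_, fun hsub => ?_⟩
    · rw [Finset.mem_filter] at hr ⊢
      exact ⟨hr.1, hr.2.trans hqq'⟩
    · have := hsub (Finset.mem_filter.2 ⟨hq, hqq'⟩)
      exact lt_irrefl _ (Finset.mem_filter.1 this).2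
  obtain ⟨v, hv⟩ := hsat.exists_realize hκ (fun q : PEmpty.{w + 1} => q.elim)
    (by simpa using Cardinal.aleph0_pos.trans hκ)
    ((hyperfilter ℕ).map fun n (p : ℚ × Fin m) => b (rk n p.1) p.2)
  have key : ∀ (n : ℕ) (φ : L.Formula (Fin n × Fin m)) (s : Fin n → ℚ) (s' : Fin n → ℕ),
      (∀ i j, s i ≤ s j ↔ s' i ≤ s' j) →
      (φ.Realize (fun q => v (s q.1, q.2)) ↔ φ.Realize fun q => b (s' q.1) q.2) := by
    intro n φ s s' hss
    have h1 := hv (φ.relabel fun q => Sum.inr (s q.1, q.2))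
    simp only [Formula.realize_relabel, Ultrafilter.coe_map, eventually_map] at h1
    have e1 : ∀ u : ℚ × Fin m → C, Sum.elim (fun q : PEmpty.{w + 1} => (q.elim : C)) u ∘
        (fun q : Fin n × Fin m => Sum.inr (s q.1, q.2)) = fun q => u (s q.1, q.2) := fun u => rfl
    simp only [e1] at h1
    refine h1.trans ?_
    have hlarge : ∀ᶠ N in (hyperfilter ℕ : Filter ℕ), ∀ i, s i ∈ F N := by
      refine Nat.hyperfilter_le_atTop (eventually_all.2 fun i => ?_)
      exact (eventually_gt_atTop (g (s i))).mono fun N hN => by simpa [F] using hN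
    rw [eventually_congr (hlarge.mono fun N hN => hb.realize_iff (fun i => rk N (s i)) s' ?_ φ),
      eventually_const]
    intro i j
    rw [← hss]
    rcases lt_trichotomy (s i) (s j) with h | h | h
    · exact iff_of_true (hrk N _ _ (hN i) h).le h.le
    · simp [h]
    · exact iff_of_false (hrk N _ _ (hN j) h).not_ge h.not_ge
  refine ⟨fun q i => v (q, i), fun n φ s t hs ht => ?_, fun hset => hnb fun n φ s t hs ht => ?_⟩
  · exact (key n φ s (fun i => i) fun i j => hs.le_iff_le).trans
      (key n φ t (fun i => i) fun i j => ht.le_iff_le).symm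
  -- On `ℕ ⊆ ℚ` the stretched sequence satisfies the same formulas as `b`, so it cannot be an
  -- indiscernible set.
  · have hc : Function.Injective ((↑) : ℕ → ℚ) := Nat.cast_injective
    exact (key n φ (fun i => (s i : ℚ)) s fun i j => Nat.cast_le).symm.trans
      ((hset n φ _ _ (hc.comp hs) (hc.comp ht)).trans
        (key n φ (fun i => (t i : ℚ)) t fun i j => Nat.cast_le))

theorem exists_quasiOrder_with_chain (hNIP : IsNIP L C) {b : ℚ → Fin 1 → C}
    (hb : IsIndiscernibleSeq L b) (hnb : ¬ IsIndiscernibleSet L b) :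
    ∃ (k : ℕ) (φ : L.Formula (Fin 2 ⊕ Fin k)) (c : Fin k → C) (R : C → C → Prop),
      (∀ a a', R a a' ↔ φ.Realize (Sum.elim ![a, a'] c)) ∧ IsQuasiOrder R ∧
      ∃ e : ℕ → C, ∀ i j, i < j → StrictlyBelow R (e i) (e j) := by
  obtain ⟨r, s, k, c, ψ, hrs, -, R, hR, ⟨hR1, hR2⟩, hchain⟩ :=
    exists_quasiOrder_of_indiscernibleSeq hNIP b hb hnb
  -- Only an increasing sequence inside the interval is needed; its limit is irrelevant.
  obtain ⟨t, ht, hts, -⟩ := exists_seq_strictMono_tendsto' hrs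
  refine ⟨k, ψ.relabel (Sum.elim (Sum.elim (fun _ => Sum.inl 0) fun _ => Sum.inl 1)
    fun q => Sum.inr q.1), fun j => b (c j) 0, fun a a' => R (fun _ => a) fun _ => a', ?_,
    ⟨fun a => hR1 _, fun _ _ _ => hR2 _ _ _⟩, fun n => b (t n) 0, fun i j hij => ?_⟩
  · intro a a'
    refine (hR _ _).trans ((iff_of_eq (congrArg _ ?_)).trans Formula.realize_relabel.symm)
    funext q
    rcases q with (q | q) | ⟨q, i⟩
    · rfl
    · rfl
    · simp [Subsingleton.elim i 0]
  · have h0 : ∀ n, (fun _ => b (t n) 0) = b (t n) := fun n => by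
      funext i; rw [Subsingleton.elim i 0]
    have := hchain (t i) (hts i) (t j) (hts j) (ht hij)
    simpa only [StrictlyBelow, h0] using this

end Main
end NIPTheory

theorem mainTheorem3 {L : FirstOrder.Language.{u, v}} (T : L.Theory) (hT : T.IsComplete)
    (C : Type w) [L.Structure C] [Nonempty C] (hC : C ⊨ T)
    (κ : Cardinal.{w})
    (hκ : Cardinal.lift.{w} (max ℵ₀ L.card) < Cardinal.lift.{max u v} κ)
    (hsat : NIPTheory.IsSaturated L C κ)
    (hNIP : NIPTheory.IsNIP L C) (hunst : ¬ NIPTheory.IsStable T) :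
    -- a nonstable 1-type over a small model
    (∃ M : L.ElementarySubstructure C, #M < κ ∧
      ∃ p : NIPTheory.TypesOver L 1 (M : Set C), ¬ NIPTheory.IsStableType p) ∧
    -- an indiscernible sequence of single elements that is not an indiscernible set
    (∃ b : ℕ → Fin 1 → C,
      NIPTheory.IsIndiscernibleSeq L b ∧ ¬ NIPTheory.IsIndiscernibleSet L b) ∧
    -- a quasi-order on tuples from an indiscernible sequence that is not an indiscernible set
    (∀ (I : Type x) [LinearOrder I] [DenselyOrdered I] (m : ℕ) (b : I → Fin m → C),
      NIPTheory.IsIndiscernibleSeq L b → ¬ NIPTheory.IsIndiscernibleSet L b →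
      ∃ (r s : I) (k : ℕ) (c : Fin k → I)
        (ψ : L.Formula ((Fin m ⊕ Fin m) ⊕ (Fin k × Fin m))),
        r < s ∧ (∀ j, c j ∉ Set.Ioo r s) ∧
        ∃ R : (Fin m → C) → (Fin m → C) → Prop,
          (∀ a a', R a a' ↔ ψ.Realize (Sum.elim (Sum.elim a a') (fun q => b (c q.1) q.2))) ∧
          NIPTheory.IsQuasiOrder R ∧
          ∀ t ∈ Set.Ioo r s, ∀ t' ∈ Set.Ioo r s, t < t' →
            NIPTheory.StrictlyBelow R (b t) (b t')) ∧
    -- a definable quasi-order on elements with an infinite chain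
    (∃ (k : ℕ) (φ : L.Formula (Fin 2 ⊕ Fin k)) (c : Fin k → C) (R : C → C → Prop),
      (∀ a a', R a a' ↔ φ.Realize (Sum.elim ![a, a'] c)) ∧
      NIPTheory.IsQuasiOrder R ∧
      ∃ e : ℕ → C, ∀ i j, i < j → NIPTheory.StrictlyBelow R (e i) (e j)) := by
  obtain ⟨k, φ, hφ⟩ := NIPTheory.exists_hasOP_of_not_isStable hT C hunst
  have hκ0 : ℵ₀ < κ := by
    rw [← Cardinal.aleph0_lt_lift.{w, max u v}]
    refine lt_of_le_of_lt ?_ hκ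
    rw [Cardinal.aleph0_le_lift]
    exact le_max_left _ _
  obtain ⟨a, c, hac⟩ := hφ.exists_seq hsat hκ0
  obtain ⟨M, hM, D, hD⟩ := NIPTheory.exists_not_isSymmetric hκ hNIP φ a c hac
  obtain ⟨b₀, hb₀⟩ := hsat.exists_tp_eq_average hκ0 D (M : Set C) hM
  obtain ⟨b, hb⟩ := hsat.exists_isAverageSeq hκ0 hM D
  have hnb : ¬ NIPTheory.IsIndiscernibleSet L b := fun hset => hD (hb.isSymmetric hset)
  -- The nonstable type is the average of `D` over `M`, obtained as a complete type from its
  -- realization `b₀`.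
  refine ⟨⟨M, hM, Language.Theory.typeOf _ b₀, ?_⟩, ⟨b, hb.isIndiscernibleSeq, hnb⟩, ?_, ?_⟩
  · refine NIPTheory.not_isStableType_of_not_isSymmetric hNIP hD _ ?_
    rw [← hb₀, NIPTheory.formulas_typeOf]
  · intro I _ _ m b hb hnb
    exact NIPTheory.exists_quasiOrder_of_indiscernibleSeq hNIP b hb hnb
  · obtain ⟨b', hb', hnb'⟩ := hsat.exists_stretch hκ0 hb.isIndiscernibleSeq hnb
    exact NIPTheory.exists_quasiOrder_with_chain hNIP hb' hnb'
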